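/- Setting. Let $0<p<1$, $\beta\in[0,\tfrac12)$, $n=2^m$, $\delta_n=2^{-n^\beta}$. Alice holds $\ell$ messages, the rows of $\underline V_{\mathcal L}\in\mathbb F_2^{\ell\times n}$, whose bits are i.i.d. with $P(V=1)=p$; she and Bob share an independent uniform seed matrix $\underline U\in\mathbb F_2^{\ell\times d_J}$. They are connected by $\ell$ noiseless links; IT-Eve reads any $w<\ell$ of them. Source code. For one row $V$ put $A=V^TG_n$, where $G_n=P_n\begin{bmatrix}1&0\\1&1\end{bmatrix}^{\otimes m}$ and $P_n$ is the bit-reversal matrix, and let $\mathcal H=\{j:H(A^{(j)}|A^{j-1})>1-\delta_n\}$, $\mathcal U=\{j:H(A^{(j)}|A^{j-1})<\delta_n\}$, $\mathcal J=(\mathcal H\cup\mathcal U)^c$ (entropies in bits). Assume $d_J\ge|\mathcal J|$. The row is compressed to $M=[A[\mathcal H],A[\mathcal J]\oplus U]$ (using the first $|\mathcal J|$ bits of its seed row), of length $\tilde n=|\mathcal H|+|\mathcal J|$. The source decoder removes the pad, estimates the bits in $\mathcal U$ by successive cancellation, and inverts $G_n$. Channel code. A binned codebook has $2^{k_s}$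 bins of $2^{\ell-k_s}$ codewords in $\mathbb F_2^\ell$. Each column of the compressed $\ell\times\tilde n$ matrix is encoded with the same codebook: its first $k_s$ bits select the bin, the others the codeword in the bin. Bob decodes a column if the received word occurs exactly once in the codebook, and otherwise declares an error. In the random code all codewords are drawn independently and uniformly from $\mathbb F_2^\ell$. Bob observes $\underline Y_{\mathcal L}=\underline X_{\mathcal L}$, the codeword matrix, and IT-Eve its rows $\underline Z_{\mathcal W}$ in $\mathcal W$. Let $\mathbb V(P,Q)=\sum_z|P(z)-Q(z)|$, let $t\ge1$, and let $c$ be an absolute constant. Put $$\epsilon_s=\tilde n\,\ell^{-t/2}+2\sqrt{2\tilde n\ell 2^{-n^\beta}},\qquad \epsilon_e=\tilde n\,c\,2^{-\ell}+\sqrt{2\tilde n\ell 2^{-n^\beta}}+\ell2^{-n^\beta}.$$ Theorem. There is an absolute constant $c$ such that the following holds for all such $p,\beta,t$ and all sequences $\ell,w,\ell\epsilon,d_J$ of non-negative integers (indexed by $m$) with $w<\ell$, $d_J\ge|\mathcal J|$, $\ell\epsilon=o(\ell)$, $\ell=\omega(\tilde n^{2/t})$ and $\ell=o(2^{n^\beta}/\tilde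 n)$. (i) (Achievability.) For all sufficiently large $m$ such that $\ell\epsilon\ge(t+1)\log_2\ell$, and every $k_s\le\ell-w-\ell\epsilon$, some codebook of the random code satisfies $$\mathbb P\big(\hat{\underline V}_{\mathcal L}(\underline Y_{\mathcal L})\ne\underline V_{\mathcal L}\big)\le\epsilon_e$$ and, simultaneously for all sets $\mathcal W$ of $w$ links, all sets $\mathcal K_s$ of $k_s$ messages and all values $\underline v_{\mathcal K_s}$, $$\mathbb V\big(p_{\underline Z_{\mathcal W}|\underline V_{\mathcal K_s}=\underline v_{\mathcal K_s}},\,p_{\underline Z_{\mathcal W}}\big)\le\epsilon_s .$$ (ii) (Mean over the random code.) For every $m$ with $\ell\epsilon\ge t\log_2\ell$, in particular for $\ell\epsilon=\lceil t\log_2\ell\rceil$, every $k_s\le\ell-w-\ell\epsilon$ and every $\mathcal W,\mathcal K_s,\underline v_{\mathcal K_s}$ as in (i), the mean of $\mathbb V(p_{\underline Z_{\mathcal W}|\underline V_{\mathcal K_s}=\underline v_{\mathcal K_s}},p_{\underline Z_{\mathcal W}})$ over the random codebook is at most $\epsilon_s$. (iii) $\epsilon_s\to0$ and $\epsilon_e\to0$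 as $m\to\infty$. -/

import Mathlib

open Filter Topology Asymptotics

noncomputable section

namespace NUHUNCC

/-! ### Binary memoryless source and polarization -/

/-- The law of one source bit: `P(V = 1) = p`, `P(V = 0) = 1 - p`. -/
def bern (p : ℝ) (b : ZMod 2) : ℝ := if b = 1 then p else 1 - p

/-- Probability of a block of `n` i.i.d. source bits. -/
def srcProb (p : ℝ) {n : ℕ} (v : Fin n → ZMod 2) : ℝ := ∏ i, bern p (v i)

/-- The `2 × 2` polarization kernel `[1 0; 1 1]`. -/
def kernel : Matrix Bool Bool (ZMod 2) := fun a b => if !a && b then 0 else 1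

/-- The `m`-fold Kronecker power of the kernel: its `(i, j)` entry is the product of the kernel
entries at the binary digits of `i` and `j`. -/
def kernelPow (m : ℕ) : Matrix (Fin (2 ^ m)) (Fin (2 ^ m)) (ZMod 2) :=
  fun i j => ∏ k : Fin m, kernel ((i : ℕ).testBit k) ((j : ℕ).testBit k)

/-- The bit-reversal permutation matrix. -/
def bitReversal (m : ℕ) : Matrix (Fin (2 ^ m)) (Fin (2 ^ m)) (ZMod 2) :=
  fun i j => if ∀ k : Fin m, (i : ℕ).testBit k = (j : ℕ).testBit k.rev then 1 else 0

/-- The polarization transform `G_n = P_n [1 0; 1 1]^{⊗ m}`, `n = 2 ^ m`. -/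
def polarMatrix (m : ℕ) : Matrix (Fin (2 ^ m)) (Fin (2 ^ m)) (ZMod 2) :=
  bitReversal m * kernelPow m

/-- The polarized vector `A = Vᵀ G_n`. -/
def polarize (m : ℕ) (v : Fin (2 ^ m) → ZMod 2) : Fin (2 ^ m) → ZMod 2 :=
  Matrix.vecMul v (polarMatrix m)

/-- Probability that the first `k` bits of `A` agree with those of `a`. -/
def prefixProb (p : ℝ) (m k : ℕ) (a : Fin (2 ^ m) → ZMod 2) : ℝ :=
  open Classical in
  ∑ v : Fin (2 ^ m) → ZMod 2,
    if ∀ i : Fin (2 ^ m), (i : ℕ) < k → polarize m v i = a i then srcProb p v else 0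

/-- The conditional entropy (in bits) of the `j`-th bit of `A` given all the earlier ones, i.e. the
expectation of `- log₂ P(A_j | A_0, …, A_{j-1})`. -/
def condEntropy (p : ℝ) (m : ℕ) (j : Fin (2 ^ m)) : ℝ :=
  -∑ a : Fin (2 ^ m) → ZMod 2, prefixProb p m (2 ^ m) a *
    Real.logb 2 (prefixProb p m (j + 1) a / prefixProb p m j a)

/-- `δ_n = 2 ^ (- n ^ β)` with `n = 2 ^ m`. -/
def delta (β : ℝ) (m : ℕ) : ℝ := (2 : ℝ) ^ (-(((2 : ℝ) ^ m) ^ β))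

/-- Indices of entropy almost one. -/
def highSet (p β : ℝ) (m : ℕ) : Finset (Fin (2 ^ m)) :=
  open Classical in Finset.univ.filter fun j => 1 - delta β m < condEntropy p m j

/-- Indices of entropy almost zero. -/
def lowSet (p β : ℝ) (m : ℕ) : Finset (Fin (2 ^ m)) :=
  open Classical in Finset.univ.filter fun j => condEntropy p m j < delta β m

/-- The remaining, unpolarized, indices. -/
def midSet (p β : ℝ) (m : ℕ) : Finset (Fin (2 ^ m)) :=
  (lowSet p β m ∪ highSet p β m)ᶜ

/-- The index set of the compressed bits of one message, `A[H]` followed by the padded `A[J]`;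
these are also the columns of the message matrix. -/
abbrev Cols (p β : ℝ) (m : ℕ) : Type := highSet p β m ⊕ midSet p β m

/-- The length `ñ = |H| + |J|` of a compressed message. -/
def compLen (p β : ℝ) (m : ℕ) : ℕ := (highSet p β m).card + (midSet p β m).card

/-! ### Source code -/

/-- The seed bit that pads `A_j`, `j ∈ J`: the `r`-th element of `J` uses the `r`-th seed bit.
(If the seed were too short, the last bits of `A[J]` would stay unpadded.) -/
def padBit (p β : ℝ) (m : ℕ) {d : ℕ} (u : Fin d → ZMod 2) (j : midSet p β m) : ZMod 2 :=
  if h : ((midSet p β m).filter (· < j.1)).card < d then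
    u ⟨((midSet p β m).filter (· < j.1)).card, h⟩ else 0

/-- The source encoder `f_{s,n}(v, u) = [A[H], A[J] ⊕ u]`. -/
def srcEncode (p β : ℝ) (m : ℕ) {d : ℕ} (v : Fin (2 ^ m) → ZMod 2) (u : Fin d → ZMod 2) :
    Cols p β m → ZMod 2 :=
  Sum.elim (fun j => polarize m v j.1) (fun j => polarize m v j.1 + padBit p β m u j)

/-- First `k` steps of successive cancellation: bits outside the low-entropy set are read off
from `a`, and a bit in the low-entropy set is set to its more likely value given the bits
estimated before it. -/
def scSteps (p β : ℝ) (m : ℕ) (a : Fin (2 ^ m) → ZMod 2) : ℕ → (Fin (2 ^ m) → ZMod 2)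
  | 0 => fun _ => 0
  | k + 1 =>
    open Classical in
    if h : k < 2 ^ m then
      Function.update (scSteps p β m a k) ⟨k, h⟩
        (if (⟨k, h⟩ : Fin (2 ^ m)) ∈ lowSet p β m then
          (if prefixProb p m (k + 1) (Function.update (scSteps p β m a k) ⟨k, h⟩ 0) <
              prefixProb p m (k + 1) (Function.update (scSteps p β m a k) ⟨k, h⟩ 1)
            then 1 else 0)
         else a ⟨k, h⟩)
    else scSteps p β m a k

/-- The source decoder `g_{s,n}`: remove the one-time pad from `A[J]`, run successive
cancellation, and invert the polarization transform. -/
def srcDecode (p β : ℝ) (m : ℕ) {d : ℕ} (x : Cols p β m → ZMod 2) (u : Fin d → ZMod 2) :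
    Fin (2 ^ m) → ZMod 2 :=
  open Classical in
  Matrix.vecMul
    (scSteps p β m
      (fun j => if hH : j ∈ highSet p β m then x (Sum.inl ⟨j, hH⟩)
        else if hJ : j ∈ midSet p β m then x (Sum.inr ⟨j, hJ⟩) - padBit p β m u ⟨j, hJ⟩
        else 0)
      (2 ^ m))
    (polarMatrix m)⁻¹

/-! ### Binning channel code -/

/-- A binned codebook: `2 ^ ks` bins, indexed by the first `ks` bits of a column, each with
`2 ^ (ℓ - ks)` codewords in `𝔽₂^ℓ`, indexed by the other bits of the column. -/
abbrev Codebook (ℓ ks : ℕ) : Type :=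
  ({i : Fin ℓ // (i : ℕ) < ks} → ZMod 2) → ({i : Fin ℓ // ¬ (i : ℕ) < ks} → ZMod 2) →
    (Fin ℓ → ZMod 2)

/-- The channel encoder of one column. -/
def chEncode {ℓ ks : ℕ} (C : Codebook ℓ ks) (c : Fin ℓ → ZMod 2) : Fin ℓ → ZMod 2 :=
  C (fun i => c i.1) (fun i => c i.1)

/-- The channel decoder of one column: if the received word occurs exactly once in the codebook,
return its bin index and its index inside the bin; otherwise declare an error. -/
def chDecode {ℓ ks : ℕ} (C : Codebook ℓ ks) (x : Fin ℓ → ZMod 2) : Option (Fin ℓ → ZMod 2) :=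
  open Classical in
  if h : ∃! be : ({i : Fin ℓ // (i : ℕ) < ks} → ZMod 2) × ({i : Fin ℓ // ¬ (i : ℕ) < ks} → ZMod 2),
      C be.1 be.2 = x then
    some fun i => if hi : (i : ℕ) < ks then h.choose.1 ⟨i, hi⟩ else h.choose.2 ⟨i, hi⟩
  else none

/-! ### The whole scheme -/

/-- The codeword matrix sent over the `ℓ` noiseless links (rows are links): every row of the
source matrix is compressed, then every column of the result is encoded. -/
def transmit (p β : ℝ) (m : ℕ) {ℓ ks d : ℕ} (C : Codebook ℓ ks)
    (V : Fin ℓ → Fin (2 ^ m) → ZMod 2) (U : Fin ℓ → Fin d → ZMod 2) :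
    Fin ℓ → Cols p β m → ZMod 2 :=
  fun i j => chEncode C (fun i' => srcEncode p β m (V i') (U i') j) i

/-- Bob's decoder; `none` if some column cannot be decoded. -/
def bobDecode (p β : ℝ) (m : ℕ) {ℓ ks d : ℕ} (C : Codebook ℓ ks)
    (X : Fin ℓ → Cols p β m → ZMod 2) (U : Fin ℓ → Fin d → ZMod 2) :
    Option (Fin ℓ → Fin (2 ^ m) → ZMod 2) :=
  if h : ∀ j, (chDecode C (fun i => X i j)).isSome then
    some fun i => srcDecode p β m (fun j => (chDecode C (fun i' => X i' j)).get (h j) i) (U i)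
  else none

/-- Probability of an event about the source matrix (i.i.d. bits of law `bern p`) and the
independent uniform seed matrix. -/
def prob (p : ℝ) {n ℓ d : ℕ}
    (E : (Fin ℓ → Fin n → ZMod 2) → (Fin ℓ → Fin d → ZMod 2) → Prop) : ℝ :=
  open Classical in
  ∑ V : Fin ℓ → Fin n → ZMod 2, ∑ U : Fin ℓ → Fin d → ZMod 2,
    if E V U then (∏ i, srcProb p (V i)) * ((2 : ℝ) ^ (ℓ * d))⁻¹ else 0

/-- Bob's error probability. -/
def errorProb (p β : ℝ) (m : ℕ) {ℓ ks : ℕ} (d : ℕ) (C : Codebook ℓ ks) : ℝ :=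
  prob p (n := 2 ^ m) (ℓ := ℓ) (d := d)
    fun V U => bobDecode p β m C (transmit p β m C V U) U ≠ some V

/-- The leakage about the messages in `K` to an eavesdropper on the links in `W`: the non-normalized
variational distance between the law of her observation given `V_K = v` and its unconditional
law. -/
def leakage (p β : ℝ) (m : ℕ) {ℓ ks : ℕ} (d : ℕ) (C : Codebook ℓ ks) (W K : Finset (Fin ℓ))
    (v : K → Fin (2 ^ m) → ZMod 2) : ℝ :=
  ∑ z : W → Cols p β m → ZMod 2,
    |prob p (n := 2 ^ m) (ℓ := ℓ) (d := d)
          (fun V U => (fun i : W => transmit p β m C V U i) = z ∧ (fun i : K => V i) = v) /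
        prob p (n := 2 ^ m) (ℓ := ℓ) (d := d) (fun V _ => (fun i : K => V i) = v) -
      prob p (n := 2 ^ m) (ℓ := ℓ) (d := d)
          (fun V U => (fun i : W => transmit p β m C V U i) = z)|

/-- The mean leakage of the random codebook all of whose codewords are drawn independently and
uniformly from `𝔽₂^ℓ` (i.e. with i.i.d. fair bits): that codebook is uniformly distributed on the
finite set of all codebooks. -/
def meanLeakage (p β : ℝ) (m : ℕ) {ℓ : ℕ} (ks d : ℕ) (W K : Finset (Fin ℓ))
    (v : K → Fin (2 ^ m) → ZMod 2) : ℝ :=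
  (∑ C : Codebook ℓ ks, leakage p β m d C W K v) / (Fintype.card (Codebook ℓ ks) : ℝ)

/-- `ε_s = ñ ℓ^{-t/2} + 2 √(2 ñ ℓ 2^{-n^β})`. -/
def leakBound (p β t : ℝ) (m ℓ : ℕ) : ℝ :=
  (compLen p β m : ℝ) * (ℓ : ℝ) ^ (-(t / 2)) +
    2 * Real.sqrt (2 * (compLen p β m : ℝ) * (ℓ : ℝ) * delta β m)

/-- `ε_e = ñ · c 2^{-ℓ} + √(2 ñ ℓ 2^{-n^β}) + ℓ 2^{-n^β}`. -/
def errBound (c p β : ℝ) (m ℓ : ℕ) : ℝ :=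
  (compLen p β m : ℝ) * (c * (2 : ℝ) ^ (-(ℓ : ℝ))) +
    Real.sqrt (2 * (compLen p β m : ℝ) * (ℓ : ℝ) * delta β m) + (ℓ : ℝ) * delta β m

end NUHUNCC

end

/-! The leakage bound replaces the true source law by one under which the compressed matrix is
exactly uniform. In `refLaw` the polarized bits in `highSet` are fair and independent, while every
other bit keeps its conditional law given the past. By the chain rule its relative entropy from the
source is `log 2` times the sum of the entropy defects `1 - H` over `highSet`, hence at most `ñ δ`
per row (`relEnt_refLaw_highSet_le`). Relative entropy adds over the `ℓ` rows, and Pinsker's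
inequality gives a distance of at most `√(2 ñ ℓ δ)`. This is paid twice, for the conditional and for
the unconditional law of the observation.

Under the reference law, with the one-time pad on `midSet`, the cells of the compressed matrix
outside the known rows are independent fair bits. The observed columns are therefore independent,
the padded ones have the same law with or without conditioning, and the leakage is at most the sum
of the leakages `colDist` of the columns in `highSet` (`leakage_le`). What remains is a question
about one column encoded by a map `f` of `𝔽₂^ℓ`.

For the mean over the random code, `f` is a uniformly random map. Its values at distinct points are
independent, so a second-moment computation and Cauchy-Schwarz give `√(2^{-ℓε})` per column
(`sum_colDist_le`).

For achievability, a bijective `f` is chosen, so that the channel decoder never fails and only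
successive cancellation can err. For a uniformly random permutation, Hoeffding's inequality for
sampling without replacement makes the column leakage exceed `ℓ^{-t/2}` with doubly exponentially
small probability. A union bound over all `W`, `K` and known column values then yields one good
permutation when `w ≥ 2` (`exists_bijective_colDist_le`). It suffices to treat the values of one
column, since the leakage has already been split into columns. For `w = 1` a parity code leaks
nothing, and for `w = 0` nothing is observed.

The source error is at most `ℓ n δ`. Since `ñ` is at least a constant times `n` for large `m`
(`compLen_ge`) and `ñ ℓ δ → 0`, the term `√(2 ñ ℓ δ)` of `ε_e` eventually absorbs it. -/

open Filter Topology Asymptotics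

noncomputable section

namespace NUHUNCC

/-! ### Sums over finite product types -/

/-- The real-valued indicator of a proposition. -/
def ind (P : Prop) : ℝ := open Classical in if P then 1 else 0

lemma ind_true {P : Prop} (h : P) : ind P = 1 := by simp [ind, h]

lemma ind_false {P : Prop} (h : ¬ P) : ind P = 0 := by simp [ind, h]

lemma ind_nonneg (P : Prop) : 0 ≤ ind P := by unfold ind; split_ifs <;> norm_num

lemma ind_le_one (P : Prop) : ind P ≤ 1 := by unfold ind; split_ifs <;> norm_num

lemma ind_and (P Q : Prop) : ind (P ∧ Q) = ind P * ind Q := by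
  by_cases hP : P <;> by_cases hQ : Q <;> simp [ind, hP, hQ]

lemma ind_forall {ι : Type*} [Fintype ι] (P : ι → Prop) : ind (∀ i, P i) = ∏ i, ind (P i) := by
  by_cases h : ∀ i, P i
  · rw [ind_true h]
    exact (Finset.prod_eq_one fun i _ => ind_true (h i)).symm
  · rw [ind_false h]
    push Not at h
    obtain ⟨i, hi⟩ := h
    exact (Finset.prod_eq_zero (Finset.mem_univ i) (ind_false hi)).symm

lemma ind_mono {P Q : Prop} (h : P → Q) : ind P ≤ ind Q := by
  by_cases hP : P
  · rw [ind_true hP, ind_true (h hP)]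
  · rw [ind_false hP]; exact ind_nonneg _

lemma ind_exists_le {ι : Type*} (s : Finset ι) (P : ι → Prop) :
    ind (∃ i ∈ s, P i) ≤ ∑ i ∈ s, ind (P i) := by
  by_cases h : ∃ i ∈ s, P i
  · obtain ⟨i, hi, hP⟩ := h
    calc ind _ ≤ 1 := ind_le_one _
      _ = ind (P i) := (ind_true hP).symm
      _ ≤ _ := Finset.single_le_sum (f := fun i => ind (P i)) (fun i _ => ind_nonneg _) hi
  · rw [ind_false h]
    exact Finset.sum_nonneg fun i _ => ind_nonneg _

lemma sum_ind_eq {X : Type*} [Fintype X] (x : X) (f : X → ℝ) :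
    ∑ y, ind (x = y) * f y = f x := by
  classical
  rw [Finset.sum_eq_single x]
  · simp [ind]
  · intro y _ hy; rw [ind_false (Ne.symm hy), zero_mul]
  · simp

lemma sum_ind_eq' {X : Type*} [Fintype X] (x : X) (f : X → ℝ) :
    ∑ y, ind (y = x) * f y = f x := by
  rw [← sum_ind_eq x f]
  simp only [eq_comm]

lemma sum_pi_prod {ι : Type*} [DecidableEq ι] [Fintype ι] {Y : Type*} [Fintype Y]
    (g : ι → Y → ℝ) : ∑ z : ι → Y, ∏ i, g i (z i) = ∏ i, ∑ y, g i y := by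
  rw [Finset.prod_univ_sum]
  simp

/-- Exchanging coordinate `i` of `z` with the spare value `b` is an involution of `(ι → Y) × Y`.
This resamples one coordinate without splitting the function space. -/
lemma sum_sum_update {ι : Type*} [DecidableEq ι] [Fintype ι] {Y : Type*} [Fintype Y]
    (F : (ι → Y) → ℝ) (i : ι) :
    ∑ z : ι → Y, ∑ b, F (Function.update z i b) = Fintype.card Y * ∑ z, F z := by
  let e : Equiv.Perm ((ι → Y) × Y) :=
    { toFun := fun q => (Function.update q.1 i q.2, q.1 i)
      invFun := fun q => (Function.update q.1 i q.2, q.1 i)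
      left_inv := fun q => by ext <;> simp
      right_inv := fun q => by ext <;> simp }
  have h := Equiv.sum_comp e (fun q => F q.1)
  rw [Fintype.sum_prod_type, Fintype.sum_prod_type] at h
  simp only [e, Equiv.coe_fn_mk] at h
  rw [h]
  simp [Finset.mul_sum]

lemma prod_update_apply {ι : Type*} [DecidableEq ι] [Fintype ι] {Y : Type*}
    (h : ι → Y → ℝ) (i : ι) (φ : Y → ℝ) (z : ι → Y) :
    ∏ j, Function.update h i φ j (z j) = φ (z i) * ∏ j ∈ Finset.univ.erase i, h j (z j) := by
  rw [← Finset.mul_prod_erase Finset.univ _ (Finset.mem_univ i)]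
  congr 1
  · simp
  · refine Finset.prod_congr rfl fun j hj => ?_
    rw [Function.update_of_ne (Finset.ne_of_mem_erase hj)]

lemma sum_update_prod {ι : Type*} [DecidableEq ι] [Fintype ι] {Y : Type*} [Fintype Y]
    (h : ι → Y → ℝ) (h1 : ∀ j, ∑ y, h j y = 1) (i : ι) (φ : Y → ℝ) :
    ∑ z : ι → Y, φ (z i) * ∏ j ∈ Finset.univ.erase i, h j (z j) = ∑ y, φ y := by
  simp_rw [← prod_update_apply]
  rw [sum_pi_prod, ← Finset.mul_prod_erase Finset.univ _ (Finset.mem_univ i)]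
  rw [Finset.prod_eq_one, mul_one]
  · simp
  · intro j hj
    rw [Function.update_of_ne (Finset.ne_of_mem_erase hj), h1]

lemma sum_prod_mul_apply {ι : Type*} [DecidableEq ι] [Fintype ι] {Y : Type*} [Fintype Y]
    (h : ι → Y → ℝ) (h1 : ∀ j, ∑ y, h j y = 1) (i : ι) (φ : Y → ℝ) :
    ∑ z : ι → Y, (∏ j, h j (z j)) * φ (z i) = ∑ y, h i y * φ y := by
  rw [← sum_update_prod h h1 i]
  refine Finset.sum_congr rfl fun z _ => ?_
  rw [← Finset.mul_prod_erase Finset.univ _ (Finset.mem_univ i)]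
  ring

/-- Hybrid argument: the factors `g i` are replaced by `f i` one at a time. Consecutive hybrids
differ in a single factor, and the other factors sum to one. -/
lemma sum_abs_prod_sub_prod_le {ι : Type*} [DecidableEq ι] [Fintype ι] {Y : Type*} [Fintype Y]
    (f g : ι → Y → ℝ) (f0 : ∀ i y, 0 ≤ f i y) (g0 : ∀ i y, 0 ≤ g i y)
    (f1 : ∀ i, ∑ y, f i y = 1) (g1 : ∀ i, ∑ y, g i y = 1) :
    ∑ z : ι → Y, |∏ i, f i (z i) - ∏ i, g i (z i)| ≤ ∑ i, ∑ y, |f i y - g i y| := by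
  have key : ∀ s : Finset ι,
      ∑ z : ι → Y, |∏ i, (if i ∈ s then f i else g i) (z i) - ∏ i, g i (z i)| ≤
        ∑ i ∈ s, ∑ y, |f i y - g i y| := by
    intro s
    induction s using Finset.induction_on with
    | empty => simp
    | insert i s his ih =>
      rw [Finset.sum_insert his]
      set h : ι → Y → ℝ := fun j => if j ∈ s then f j else g j with hh
      have h1 : ∀ j, ∑ y, h j y = 1 := by
        intro j; by_cases hj : j ∈ s <;> simp [hh, hj, f1, g1]
      have h0 : ∀ j y, 0 ≤ h j y := by
        intro j; by_cases hj : j ∈ s <;> simp [hh, hj, f0, g0]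
      have e1 : (fun j => if j ∈ insert i s then f j else g j) = Function.update h i (f i) := by
        funext j
        by_cases hj : j = i
        · subst hj; simp
        · simp [hj, hh]
      have e2 : h = Function.update h i (g i) := by
        rw [eq_comm, Function.update_eq_self_iff]; simp [hh, his]
      have e3 : ∀ z : ι → Y, |∏ j, (if j ∈ insert i s then f j else g j) (z j) - ∏ j, h j (z j)| =
          |f i (z i) - g i (z i)| * ∏ j ∈ Finset.univ.erase i, h j (z j) := by
        intro z
        have a1 := congrArg (fun k : ι → Y → ℝ => ∏ j, k j (z j)) e1
        have a2 := congrArg (fun k : ι → Y → ℝ => ∏ j, k j (z j)) e2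
        simp only [prod_update_apply] at a1 a2
        rw [a1, a2, ← sub_mul, abs_mul, abs_of_nonneg (Finset.prod_nonneg fun j _ => h0 j _)]
      calc _ ≤ ∑ z : ι → Y, (|∏ j, (if j ∈ insert i s then f j else g j) (z j) - ∏ j, h j (z j)| +
              |∏ j, h j (z j) - ∏ j, g j (z j)|) :=
            Finset.sum_le_sum fun z _ => abs_sub_le _ _ _
        _ ≤ _ := by
          rw [Finset.sum_add_distrib]
          refine add_le_add (le_of_eq ?_) ih
          simp_rw [e3]
          exact sum_update_prod h h1 i (fun y => |f i y - g i y|)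
  simpa using key Finset.univ

/-! ### Pinsker's inequality on finite types -/

lemma two_mul_sub_one_le_add_one_mul_log {x : ℝ} (hx : 1 ≤ x) :
    2 * (x - 1) ≤ (x + 1) * Real.log x := by
  have h := Real.le_log_one_add_of_nonneg (x := x - 1) (by linarith)
  rw [div_le_iff₀ (by linarith)] at h
  have e : 1 + (x - 1) = x := by ring
  rw [e] at h
  nlinarith

lemma add_one_mul_log_le_two_mul_sub_one {x : ℝ} (h0 : 0 < x) (hx : x ≤ 1) :
    (x + 1) * Real.log x ≤ 2 * (x - 1) := by
  have h := two_mul_sub_one_le_add_one_mul_log (x := x⁻¹) ((one_le_inv₀ h0).2 hx)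
  rw [Real.log_inv] at h
  have h2 := mul_le_mul_of_nonneg_left h h0.le
  have e1 : x * (2 * (x⁻¹ - 1)) = 2 * (1 - x) := by field_simp
  have e2 : x * ((x⁻¹ + 1) * -Real.log x) = -((x + 1) * Real.log x) := by field_simp; ring
  rw [e1, e2] at h2
  linarith

/-- Pointwise form of Pinsker's inequality, applied later at `x = P / R`. The difference `F` of the
two sides vanishes at `1`, and its derivative `4 ((x + 1) log x - 2 (x - 1))` has the sign of `x -
1`, so `1` is its minimum. -/
lemma three_mul_sq_le_mul_klFun {x : ℝ} (hx : 0 < x) :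
    3 * (x - 1) ^ 2 ≤ (2 * x + 4) * (x * Real.log x - x + 1) := by
  set F : ℝ → ℝ := fun x => (2 * x + 4) * (x * Real.log x - x + 1) - 3 * (x - 1) ^ 2 with hF
  have hd : ∀ y : ℝ, 0 < y → HasDerivAt F (4 * ((y + 1) * Real.log y - 2 * (y - 1))) y := by
    intro y hy
    have h1 : HasDerivAt (fun x : ℝ => 2 * x + 4) 2 y := by
      simpa using ((hasDerivAt_id y).const_mul 2).add_const 4
    have h2 : HasDerivAt (fun x : ℝ => x * Real.log x - x + 1) (Real.log y) y := by
      have := (((hasDerivAt_id y).mul (Real.hasDerivAt_log hy.ne')).sub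
        (hasDerivAt_id y)).add_const 1
      refine this.congr_deriv ?_
      simp [hy.ne']
    have h3 : HasDerivAt (fun x : ℝ => 3 * (x - 1) ^ 2) (3 * (2 * (y - 1))) y := by
      have := (((hasDerivAt_id y).sub_const 1).pow 2).const_mul 3
      refine this.congr_deriv ?_
      simp
    refine ((h1.mul h2).sub h3).congr_deriv ?_
    ring
  have hF1 : F 1 = 0 := by simp [hF]
  suffices h : 0 ≤ F x by simp only [hF] at h; linarith
  rcases le_total 1 x with h1 | h1
  · have hm : MonotoneOn F (Set.Ici 1) := by
      refine monotoneOn_of_deriv_nonneg (convex_Ici 1) ?_ ?_ ?_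
      · intro y hy
        exact (hd y (lt_of_lt_of_le one_pos hy)).continuousAt.continuousWithinAt
      · intro y hy
        rw [interior_Ici] at hy
        exact (hd y (one_pos.trans hy)).differentiableAt.differentiableWithinAt
      · intro y hy
        rw [interior_Ici] at hy
        rw [(hd y (one_pos.trans hy)).deriv]
        have := two_mul_sub_one_le_add_one_mul_log (le_of_lt hy)
        linarith
    have := hm (Set.mem_Ici.2 le_rfl) (Set.mem_Ici.2 h1) h1
    linarith
  · have hm : AntitoneOn F (Set.Ioc 0 1) := by
      refine antitoneOn_of_deriv_nonpos (convex_Ioc 0 1) ?_ ?_ ?_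
      · intro y hy
        exact (hd y hy.1).continuousAt.continuousWithinAt
      · intro y hy
        rw [interior_Ioc] at hy
        exact (hd y hy.1).differentiableAt.differentiableWithinAt
      · intro y hy
        rw [interior_Ioc] at hy
        rw [(hd y hy.1).deriv]
        have := add_one_mul_log_le_two_mul_sub_one hy.1 hy.2.le
        linarith
    have := hm ⟨hx, h1⟩ ⟨one_pos, le_rfl⟩ h1
    linarith

/-- The relative entropy (in nats) of two weight functions on a finite type. -/
def relEnt {X : Type*} [Fintype X] (P R : X → ℝ) : ℝ := ∑ x, P x * Real.log (P x / R x)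

/-- Pinsker's inequality by Cauchy-Schwarz with the weights `(2 P + 4 R) / 3`, whose total mass is
`2`. The terms `- P + R` make the other factor nonnegative pointwise and cancel in the sum. -/
lemma sq_sum_abs_sub_le_relEnt {X : Type*} [Fintype X] (P R : X → ℝ) (P0 : ∀ x, 0 ≤ P x)
    (R0 : ∀ x, 0 ≤ R x) (P1 : ∑ x, P x = 1) (R1 : ∑ x, R x = 1)
    (h : ∀ x, R x = 0 → P x = 0) :
    (∑ x, |P x - R x|) ^ 2 ≤ 2 * relEnt P R := by
  have key : ∀ x, 0 ≤ P x * Real.log (P x / R x) - P x + R x ∧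
      |P x - R x| ^ 2 ≤
        (2 * P x + 4 * R x) / 3 * (P x * Real.log (P x / R x) - P x + R x) := by
    intro x
    rcases (P0 x).eq_or_lt with hP | hP
    · rw [← hP]
      refine ⟨by simpa using R0 x, ?_⟩
      have := R0 x
      simp only [zero_sub, abs_neg, sq_abs]
      nlinarith [sq_nonneg (R x)]
    · have hR : 0 < R x := lt_of_le_of_ne (R0 x) fun h0 => hP.ne' (h x h0.symm)
      have hx : 0 < P x / R x := div_pos hP hR
      have e : P x = P x / R x * R x := by field_simp
      have l1 := Real.one_sub_inv_le_log_of_pos hx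
      have l2 := three_mul_sq_le_mul_klFun hx
      set y := P x / R x
      constructor
      · rw [e]
        have : y * (1 - y⁻¹) ≤ y * Real.log y := mul_le_mul_of_nonneg_left l1 hx.le
        rw [mul_sub, mul_inv_cancel₀ hx.ne'] at this
        nlinarith
      · rw [sq_abs, e]
        have := mul_le_mul_of_nonneg_left l2 (sq_nonneg (R x))
        nlinarith
  have cs := Finset.sum_sq_le_sum_mul_sum_of_sq_le_mul Finset.univ
    (r := fun x => |P x - R x|) (f := fun x => (2 * P x + 4 * R x) / 3)
    (g := fun x => P x * Real.log (P x / R x) - P x + R x)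
    (fun x _ => by have := P0 x; have := R0 x; positivity) (fun x _ => (key x).1)
    (fun x _ => (key x).2)
  refine cs.trans (le_of_eq ?_)
  have s1 : ∑ x, (2 * P x + 4 * R x) / 3 = 2 := by
    rw [← Finset.sum_div, Finset.sum_add_distrib, ← Finset.mul_sum, ← Finset.mul_sum, P1, R1]
    norm_num
  have s2 : ∑ x, (P x * Real.log (P x / R x) - P x + R x) = relEnt P R := by
    rw [Finset.sum_add_distrib, Finset.sum_sub_distrib, P1, R1, relEnt]
    ring
  rw [s1, s2]

lemma relEnt_pi {ι : Type*} [DecidableEq ι] [Fintype ι] {Y : Type*} [Fintype Y]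
    (f g : ι → Y → ℝ) (f1 : ∀ i, ∑ y, f i y = 1) (h : ∀ i y, g i y = 0 → f i y = 0) :
    relEnt (fun z : ι → Y => ∏ i, f i (z i)) (fun z => ∏ i, g i (z i)) =
      ∑ i, relEnt (f i) (g i) := by
  unfold relEnt
  have e : ∀ z : ι → Y, (∏ i, f i (z i)) * Real.log ((∏ i, f i (z i)) / ∏ i, g i (z i)) =
      ∑ i, (∏ j, f j (z j)) * Real.log (f i (z i) / g i (z i)) := by
    intro z
    rw [← Finset.mul_sum]
    by_cases h0 : ∃ i, f i (z i) = 0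
    · obtain ⟨i, hi⟩ := h0
      rw [Finset.prod_eq_zero (Finset.mem_univ i) hi, zero_mul, zero_mul]
    · push Not at h0
      rw [← Finset.prod_div_distrib, Real.log_prod]
      intro i _
      exact div_ne_zero (h0 i) fun h' => h0 i (h i _ h')
  simp_rw [e]
  rw [Finset.sum_comm]
  exact Finset.sum_congr rfl fun i _ =>
    sum_prod_mul_apply f f1 i (fun y => Real.log (f i y / g i y))

/-! ### Invertibility of the polarization transform -/

/-- If `i < j`, some binary digit is `1` in `j` and `0` in `i`, and the kernel vanishes there. The
matrix is thus lower triangular, with ones on the diagonal. -/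
lemma det_kernelPow (m : ℕ) : (kernelPow m).det = 1 := by
  rw [Matrix.det_of_isLowerTriangular]
  · refine Finset.prod_eq_one fun i _ => Finset.prod_eq_one fun k _ => ?_
    cases (i : ℕ).testBit k <;> simp [kernel]
  · intro i j hij
    by_contra h
    have hij' : i < j := hij
    refine absurd (Fin.lt_def.1 hij') (not_lt.2 (Nat.le_of_testBit fun k hk => ?_))
    have hkm : k < m := by
      by_contra hkm
      have : (j : ℕ).testBit k = false :=
        Nat.testBit_lt_two_pow (j.2.trans_le (Nat.pow_le_pow_right two_pos (not_lt.1 hkm)))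
      simp [this] at hk
    by_contra hi
    refine h (Finset.prod_eq_zero (Finset.mem_univ ⟨k, hkm⟩) ?_)
    simp [kernel, hk, hi]

/-- Reversal of the `m` binary digits of an index. -/
def bitRev (m : ℕ) (i : Fin (2 ^ m)) : Fin (2 ^ m) :=
  ⟨Nat.ofBits fun k : Fin m => (i : ℕ).testBit k.rev, Nat.ofBits_lt_two_pow _⟩

lemma testBit_bitRev (m : ℕ) (i : Fin (2 ^ m)) (k : Fin m) :
    (bitRev m i : ℕ).testBit k = (i : ℕ).testBit k.rev := by
  rw [bitRev, Nat.testBit_ofBits_lt _ _ k.2]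

lemma eq_of_testBit_eq {m : ℕ} {i j : Fin (2 ^ m)}
    (h : ∀ k : Fin m, (i : ℕ).testBit k = (j : ℕ).testBit k) : i = j := by
  refine Fin.ext (Nat.eq_of_testBit_eq fun k => ?_)
  by_cases hk : k < m
  · exact h ⟨k, hk⟩
  · have hm : 2 ^ m ≤ 2 ^ k := Nat.pow_le_pow_right two_pos (not_lt.1 hk)
    rw [Nat.testBit_lt_two_pow (i.2.trans_le hm), Nat.testBit_lt_two_pow (j.2.trans_le hm)]

lemma bitRev_involutive (m : ℕ) : Function.Involutive (bitRev m) := fun i =>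
  eq_of_testBit_eq fun k => by rw [testBit_bitRev, testBit_bitRev, Fin.rev_rev]

lemma bitReversal_mul_self (m : ℕ) : bitReversal m * bitReversal m = 1 := by
  have h : ∀ i j, bitReversal m i j = if bitRev m i = j then 1 else 0 := by
    intro i j
    unfold bitReversal
    congr 1
    rw [eq_iff_iff]
    constructor
    · intro hij
      refine eq_of_testBit_eq fun k => ?_
      rw [testBit_bitRev, hij, Fin.rev_rev]
    · rintro rfl k
      rw [testBit_bitRev, Fin.rev_rev]
  ext i j
  rw [Matrix.mul_apply]
  simp_rw [h, ite_mul, one_mul, zero_mul]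
  rw [Finset.sum_ite_eq Finset.univ (bitRev m i), if_pos (Finset.mem_univ _),
    bitRev_involutive m i, Matrix.one_apply]

lemma isUnit_det_polarMatrix (m : ℕ) : IsUnit (polarMatrix m).det := by
  rw [polarMatrix, Matrix.det_mul, det_kernelPow, mul_one]
  refine IsUnit.of_mul_eq_one (bitReversal m).det ?_
  rw [← Matrix.det_mul, bitReversal_mul_self, Matrix.det_one]

lemma vecMul_polarize_inv (m : ℕ) (v : Fin (2 ^ m) → ZMod 2) :
    Matrix.vecMul (polarize m v) (polarMatrix m)⁻¹ = v := by
  rw [polarize, Matrix.vecMul_vecMul, Matrix.mul_nonsing_inv _ (isUnit_det_polarMatrix m),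
    Matrix.vecMul_one]

lemma polarize_bijective (m : ℕ) : Function.Bijective (polarize m) :=
  Finite.injective_iff_bijective.1
    (Function.LeftInverse.injective (g := fun a => Matrix.vecMul a (polarMatrix m)⁻¹)
      (vecMul_polarize_inv m))

lemma sum_polarize (m : ℕ) (F : (Fin (2 ^ m) → ZMod 2) → ℝ) :
    ∑ v, F (polarize m v) = ∑ a, F a :=
  (polarize_bijective m).sum_comp F

/-! ### Prefix probabilities -/

lemma sum_zmod_two (f : ZMod 2 → ℝ) : ∑ b, f b = f 0 + f 1 := Fin.sum_univ_two f

lemma sum_bern (p : ℝ) : ∑ b, bern p b = 1 := by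
  rw [sum_zmod_two]; simp [bern]

lemma bern_pos {p : ℝ} (hp0 : 0 < p) (hp1 : p < 1) (b : ZMod 2) : 0 < bern p b := by
  unfold bern; split_ifs <;> linarith

lemma bern_le_max (p : ℝ) (b : ZMod 2) : bern p b ≤ max p (1 - p) := by
  unfold bern; split_ifs
  · exact le_max_left _ _
  · exact le_max_right _ _

lemma srcProb_pos {p : ℝ} (hp0 : 0 < p) (hp1 : p < 1) {n : ℕ} (v : Fin n → ZMod 2) :
    0 < srcProb p v := Finset.prod_pos fun i _ => bern_pos hp0 hp1 (v i)

lemma sum_srcProb (p : ℝ) (n : ℕ) : ∑ v : Fin n → ZMod 2, srcProb p v = 1 := by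
  unfold srcProb
  rw [sum_pi_prod (fun _ : Fin n => bern p)]
  simp [sum_bern]

lemma prefixProb_eq (p : ℝ) (m k : ℕ) (a : Fin (2 ^ m) → ZMod 2) :
    prefixProb p m k a =
      ∑ v, ind (∀ i : Fin (2 ^ m), (i : ℕ) < k → polarize m v i = a i) * srcProb p v := by
  unfold prefixProb ind
  simp

lemma prefixProb_congr (p : ℝ) (m k : ℕ) {a b : Fin (2 ^ m) → ZMod 2}
    (h : ∀ i : Fin (2 ^ m), (i : ℕ) < k → a i = b i) :
    prefixProb p m k a = prefixProb p m k b := by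
  rw [prefixProb_eq, prefixProb_eq]
  refine Finset.sum_congr rfl fun v _ => ?_
  congr 2
  refine propext (forall₂_congr fun i hi => ?_)
  rw [h i hi]

lemma prefixProb_pos {p : ℝ} (hp0 : 0 < p) (hp1 : p < 1) (m k : ℕ) (a : Fin (2 ^ m) → ZMod 2) :
    0 < prefixProb p m k a := by
  obtain ⟨v, rfl⟩ := (polarize_bijective m).2 a
  rw [prefixProb_eq]
  refine Finset.sum_pos' (fun u _ => mul_nonneg (ind_nonneg _) (srcProb_pos hp0 hp1 u).le)
    ⟨v, Finset.mem_univ _, ?_⟩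
  rw [ind_true fun _ _ => rfl, one_mul]
  exact srcProb_pos hp0 hp1 v

lemma prefixProb_zero (p : ℝ) (m : ℕ) (a : Fin (2 ^ m) → ZMod 2) : prefixProb p m 0 a = 1 := by
  rw [prefixProb_eq, ← sum_srcProb p (2 ^ m)]
  refine Finset.sum_congr rfl fun v _ => ?_
  rw [ind_true (by simp), one_mul]

lemma prefixProb_polarize (p : ℝ) (m : ℕ) (v : Fin (2 ^ m) → ZMod 2) :
    prefixProb p m (2 ^ m) (polarize m v) = srcProb p v := by
  rw [prefixProb_eq, ← sum_ind_eq' v (srcProb p)]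
  refine Finset.sum_congr rfl fun u _ => ?_
  congr 2
  refine propext ⟨fun h => (polarize_bijective m).1 (funext fun i => h i i.2), ?_⟩
  rintro rfl i _
  rfl

lemma prefixProb_anti {p : ℝ} (hp0 : 0 < p) (hp1 : p < 1) (m k : ℕ)
    (a : Fin (2 ^ m) → ZMod 2) : prefixProb p m (k + 1) a ≤ prefixProb p m k a := by
  rw [prefixProb_eq, prefixProb_eq]
  refine Finset.sum_le_sum fun v _ =>
    mul_le_mul_of_nonneg_right (ind_mono fun h i hi => h i (by omega)) (srcProb_pos hp0 hp1 v).le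

lemma sum_prefixProb_update (p : ℝ) (m : ℕ) (j : Fin (2 ^ m)) (a : Fin (2 ^ m) → ZMod 2) :
    ∑ b, prefixProb p m (j + 1) (Function.update a j b) = prefixProb p m j a := by
  simp_rw [prefixProb_eq]
  rw [Finset.sum_comm]
  refine Finset.sum_congr rfl fun v _ => ?_
  rw [← Finset.sum_mul]
  congr 1
  have h : ∀ b, ind (∀ i : Fin (2 ^ m), (i : ℕ) < j + 1 →
      polarize m v i = Function.update a j b i) =
      ind (polarize m v j = b) * ind (∀ i : Fin (2 ^ m), (i : ℕ) < j → polarize m v i = a i) := by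
    intro b
    rw [← ind_and]
    congr 1
    refine propext ⟨fun h => ⟨by simpa using h j (Nat.lt_succ_self _), fun i hi => ?_⟩, ?_⟩
    · have hij : i ≠ j := by rintro rfl; exact lt_irrefl _ hi
      simpa [hij] using h i (by omega)
    · rintro ⟨h1, h2⟩ i hi
      by_cases hij : i = j
      · subst hij; simpa using h1
      · have : (i : ℕ) ≠ j := fun h => hij (Fin.ext h)
        simpa [hij] using h2 i (by omega)
  simp_rw [h]
  exact sum_ind_eq _ (fun _ => _)

/-- The conditional probability of the `j`-th polarized bit given the earlier ones. -/
def condProb (p : ℝ) (m : ℕ) (j : Fin (2 ^ m)) (a : Fin (2 ^ m) → ZMod 2) : ℝ :=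
  prefixProb p m (j + 1) a / prefixProb p m j a

lemma condProb_congr (p : ℝ) (m : ℕ) (j : Fin (2 ^ m)) {a b : Fin (2 ^ m) → ZMod 2}
    (h : ∀ i ≤ j, a i = b i) : condProb p m j a = condProb p m j b := by
  unfold condProb
  rw [prefixProb_congr p m (j + 1) fun i hi => h i (Fin.le_def.2 (by omega)),
    prefixProb_congr p m j fun i hi => h i (Fin.le_def.2 (by omega))]

lemma condProb_pos {p : ℝ} (hp0 : 0 < p) (hp1 : p < 1) (m : ℕ) (j : Fin (2 ^ m))
    (a : Fin (2 ^ m) → ZMod 2) : 0 < condProb p m j a :=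
  div_pos (prefixProb_pos hp0 hp1 _ _ _) (prefixProb_pos hp0 hp1 _ _ _)

lemma condProb_le_one {p : ℝ} (hp0 : 0 < p) (hp1 : p < 1) (m : ℕ) (j : Fin (2 ^ m))
    (a : Fin (2 ^ m) → ZMod 2) : condProb p m j a ≤ 1 :=
  (div_le_one (prefixProb_pos hp0 hp1 _ _ _)).2 (prefixProb_anti hp0 hp1 _ _ _)

lemma sum_condProb_update {p : ℝ} (hp0 : 0 < p) (hp1 : p < 1) (m : ℕ) (j : Fin (2 ^ m))
    (a : Fin (2 ^ m) → ZMod 2) : ∑ b, condProb p m j (Function.update a j b) = 1 := by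
  have h : ∀ b, prefixProb p m j (Function.update a j b) = prefixProb p m j a := fun b =>
    prefixProb_congr p m j fun i hi =>
      Function.update_of_ne (by rintro rfl; exact lt_irrefl _ hi) _ _
  unfold condProb
  simp_rw [h]
  rw [← Finset.sum_div, sum_prefixProb_update, div_self (prefixProb_pos hp0 hp1 _ _ _).ne']

/-- Chain rule: the ratios of prefix probabilities telescope, from the empty prefix to the whole
block. -/
lemma prod_condProb {p : ℝ} (hp0 : 0 < p) (hp1 : p < 1) (m : ℕ) (v : Fin (2 ^ m) → ZMod 2) :
    ∏ j, condProb p m j (polarize m v) = srcProb p v := by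
  unfold condProb
  rw [Fin.prod_univ_eq_prod_range
    (fun j => prefixProb p m (j + 1) (polarize m v) / prefixProb p m j (polarize m v)) (2 ^ m)]
  have : ∀ n, ∏ j ∈ Finset.range n,
      prefixProb p m (j + 1) (polarize m v) / prefixProb p m j (polarize m v) =
      prefixProb p m n (polarize m v) := by
    intro n
    induction n with
    | zero => rw [Finset.prod_range_zero, prefixProb_zero]
    | succ n ih =>
      rw [Finset.prod_range_succ, ih, mul_div_cancel₀]
      exact (prefixProb_pos hp0 hp1 _ _ _).ne'
  rw [this, prefixProb_polarize]

lemma condEntropy_eq (p : ℝ) (m : ℕ) (j : Fin (2 ^ m)) :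
    condEntropy p m j = ∑ v, srcProb p v * -Real.logb 2 (condProb p m j (polarize m v)) := by
  unfold condEntropy
  rw [← sum_polarize, ← Finset.sum_neg_distrib]
  refine Finset.sum_congr rfl fun v _ => ?_
  rw [prefixProb_polarize, condProb]
  ring

lemma neg_logb_condProb_nonneg {p : ℝ} (hp0 : 0 < p) (hp1 : p < 1) (m : ℕ) (j : Fin (2 ^ m))
    (a : Fin (2 ^ m) → ZMod 2) : 0 ≤ -Real.logb 2 (condProb p m j a) :=
  neg_nonneg.2 (Real.logb_nonpos one_lt_two (condProb_pos hp0 hp1 m j a).le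
    (condProb_le_one hp0 hp1 m j a))

/-! ### Laws in which some polarized bits are replaced by fair ones -/

/-- The factors are causal: `g j` sees only the coordinates up to `j`. Summing out the last relevant
coordinate therefore removes one factor at a time. -/
lemma sum_prod_sequential {Y : Type*} [Fintype Y] [Nonempty Y] (n : ℕ)
    (g : Fin n → (Fin n → Y) → ℝ) (c : Fin n → ℝ)
    (hg : ∀ j a b, (∀ i ≤ j, a i = b i) → g j a = g j b)
    (hc : ∀ j a, ∑ b, g j (Function.update a j b) = c j) :
    ∑ a, ∏ j, g j a = ∏ j, c j := by
  have hY : (Fintype.card Y : ℝ) ≠ 0 := by exact_mod_cast Fintype.card_ne_zero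
  -- The sum always runs over all `n` coordinates, of which the product over `j < k` ignores `n -
  -- k`. The powers of the cardinality account for these free coordinates.
  have key : ∀ k ≤ n, (Fintype.card Y : ℝ) ^ k *
      ∑ a, ∏ j ∈ Finset.univ.filter (fun j : Fin n => (j : ℕ) < k), g j a =
      (Fintype.card Y : ℝ) ^ n * ∏ j ∈ Finset.univ.filter (fun j : Fin n => (j : ℕ) < k), c j := by
    intro k
    induction k with
    | zero => intro _; simp
    | succ k ih =>
      intro hk
      have hs : Finset.univ.filter (fun j : Fin n => (j : ℕ) < k + 1) =
          insert ⟨k, hk⟩ (Finset.univ.filter (fun j : Fin n => (j : ℕ) < k)) := by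
        ext j
        simp only [Finset.mem_filter, Finset.mem_univ, true_and, Finset.mem_insert, Fin.ext_iff]
        omega
      have hn : (⟨k, hk⟩ : Fin n) ∉ Finset.univ.filter (fun j : Fin n => (j : ℕ) < k) := by simp
      rw [hs, Finset.prod_insert hn, pow_succ, mul_assoc,
        ← sum_sum_update _ (⟨k, hk⟩ : Fin n), mul_left_comm, ← ih (by omega), mul_left_comm,
        Finset.mul_sum _ _ (c _)]
      congr 1
      refine Finset.sum_congr rfl fun a _ => ?_
      rw [← hc _ a, Finset.sum_mul]
      refine Finset.sum_congr rfl fun b _ => ?_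
      rw [Finset.prod_insert hn]
      congr 1
      refine Finset.prod_congr rfl fun j hj => hg j _ _ fun i hi => ?_
      have hj' : (j : ℕ) < k := by simpa using hj
      rw [Function.update_of_ne]
      rintro rfl
      exact absurd (Fin.le_def.1 hi) (by simp; omega)
  have := key n le_rfl
  simpa [hY] using this

/-- The law of a source block for which the polarized bits in `S` are independent fair bits, while
the others keep their conditional law given the past. -/
def refLaw (p : ℝ) (m : ℕ) (S : Finset (Fin (2 ^ m))) (v : Fin (2 ^ m) → ZMod 2) : ℝ :=
  ∏ j, if j ∈ S then 1 / 2 else condProb p m j (polarize m v)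

section refLaw

variable {p : ℝ} (hp0 : 0 < p) (hp1 : p < 1) (m : ℕ) (S : Finset (Fin (2 ^ m)))

include hp0 hp1

lemma refLaw_pos (v : Fin (2 ^ m) → ZMod 2) : 0 < refLaw p m S v :=
  Finset.prod_pos fun j _ => by
    split_ifs
    · norm_num
    · exact condProb_pos hp0 hp1 _ _ _

/-- Under `refLaw` the bits in `S` are exactly uniform. With the indicator distributed over the
factors, each index of `S` sums to `1 / 2` and every other index to `1`. -/
lemma sum_refLaw_mul_ind (x : Fin (2 ^ m) → ZMod 2) :
    ∑ v, refLaw p m S v * ind (∀ j ∈ S, polarize m v j = x j) = (1 / 2) ^ S.card := by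
  have h1 : ∀ v, refLaw p m S v * ind (∀ j ∈ S, polarize m v j = x j) =
      ∏ j, if j ∈ S then 1 / 2 * ind (polarize m v j = x j) else
        condProb p m j (polarize m v) := by
    intro v
    rw [ind_forall, refLaw, ← Finset.prod_mul_distrib]
    refine Finset.prod_congr rfl fun j _ => ?_
    by_cases hj : j ∈ S
    · simp [hj]
    · simp [hj, ind_true]
  simp_rw [h1]
  rw [sum_polarize m (fun a => ∏ j, if j ∈ S then 1 / 2 * ind (a j = x j) else condProb p m j a),
    sum_prod_sequential (2 ^ m) _ (fun j => if j ∈ S then 1 / 2 else 1)]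
  · rw [Finset.prod_ite_mem, Finset.univ_inter, Finset.prod_const]
  · intro j a b hab
    rw [hab j le_rfl, condProb_congr p m j hab]
  · intro j a
    by_cases hj : j ∈ S
    · simp only [hj, if_true, Function.update_self]
      rw [← Finset.mul_sum]
      have := sum_ind_eq' (x j) (fun _ => 1)
      simp only [mul_one] at this
      rw [this, mul_one]
    · simp only [hj, if_false]
      exact sum_condProb_update hp0 hp1 m j a

lemma sum_refLaw : ∑ v, refLaw p m S v = 1 := by
  unfold refLaw
  rw [sum_polarize m (fun a => ∏ j, if j ∈ S then 1 / 2 else condProb p m j a),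
    sum_prod_sequential (2 ^ m) _ (fun _ => 1)]
  · simp
  · intro j a b hab
    rw [condProb_congr p m j hab]
  · intro j a
    by_cases hj : j ∈ S
    · simp [hj]
    · simp only [hj, if_false]
      exact sum_condProb_update hp0 hp1 m j a

/-- The factors outside `S` cancel in the density ratio. An index `j ∈ S` leaves `2 * condProb`,
whose expected logarithm is `log 2` times the entropy defect of the bit. -/
lemma relEnt_refLaw :
    relEnt (srcProb p) (refLaw p m S) = Real.log 2 * ∑ j ∈ S, (1 - condEntropy p m j) := by
  have hl : Real.log 2 ≠ 0 := (Real.log_pos one_lt_two).ne'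
  have h : ∀ v : Fin (2 ^ m) → ZMod 2, srcProb p v * Real.log (srcProb p v / refLaw p m S v) =
      Real.log 2 * ∑ j ∈ S,
        (srcProb p v - srcProb p v * -Real.logb 2 (condProb p m j (polarize m v))) := by
    intro v
    conv_lhs => rw [← prod_condProb hp0 hp1 m v, refLaw, ← Finset.prod_div_distrib,
      prod_condProb hp0 hp1 m v]
    rw [Real.log_prod fun j _ => div_ne_zero (condProb_pos hp0 hp1 m j _).ne' (by
      split_ifs
      · norm_num
      · exact (condProb_pos hp0 hp1 m j _).ne'), Finset.mul_sum, Finset.mul_sum]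
    rw [← Finset.sum_subset (Finset.subset_univ S)]
    · refine Finset.sum_congr rfl fun j hj => ?_
      rw [if_pos hj, Real.log_div (condProb_pos hp0 hp1 m j _).ne' (by norm_num), one_div,
        Real.log_inv, Real.logb]
      field_simp
      ring
    · intro j _ hj
      rw [if_neg hj, div_self (condProb_pos hp0 hp1 m j _).ne', Real.log_one, mul_zero]
  unfold relEnt
  simp_rw [h]
  rw [← Finset.mul_sum, Finset.sum_comm]
  congr 1
  refine Finset.sum_congr rfl fun j _ => ?_
  rw [Finset.sum_sub_distrib, sum_srcProb, condEntropy_eq]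

/-- The defect `1 - H` is, up to the factor `log 2`, the relative entropy from `refLaw` with `S =
{j}`, which Pinsker's inequality shows to be nonnegative. -/
lemma condEntropy_le_one (j : Fin (2 ^ m)) : condEntropy p m j ≤ 1 := by
  have h := sq_sum_abs_sub_le_relEnt (srcProb p) (refLaw p m {j})
    (fun v => (srcProb_pos hp0 hp1 v).le) (fun v => (refLaw_pos hp0 hp1 m _ v).le)
    (sum_srcProb p _) (sum_refLaw hp0 hp1 m _)
    (fun v hv => absurd hv (refLaw_pos hp0 hp1 m _ v).ne')
  rw [relEnt_refLaw hp0 hp1, Finset.sum_singleton] at h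
  have h2 := (sq_nonneg _).trans h
  have h3 := Real.log_pos one_lt_two
  by_contra hc
  push Not at hc
  nlinarith

/-- By the chain rule the sum is the entropy of the block. It is at least the min-entropy, as no
block has probability above `max p (1 - p) ^ n`. -/
lemma sum_condEntropy_ge :
    2 ^ m * -Real.logb 2 (max p (1 - p)) ≤ ∑ j, condEntropy p m j := by
  simp_rw [condEntropy_eq]
  rw [Finset.sum_comm]
  have h : ∀ v : Fin (2 ^ m) → ZMod 2, srcProb p v * (2 ^ m * -Real.logb 2 (max p (1 - p))) ≤
      ∑ j, srcProb p v * -Real.logb 2 (condProb p m j (polarize m v)) := by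
    intro v
    rw [← Finset.mul_sum, Finset.sum_neg_distrib,
      ← Real.logb_prod _ _ fun j _ => (condProb_pos hp0 hp1 m j _).ne',
      prod_condProb hp0 hp1, mul_neg]
    refine mul_le_mul_of_nonneg_left (neg_le_neg ?_) (srcProb_pos hp0 hp1 v).le
    have hle : srcProb p v ≤ max p (1 - p) ^ (2 ^ m) := by
      unfold srcProb
      refine (Finset.prod_le_prod (fun i _ => (bern_pos hp0 hp1 _).le)
        fun i _ => bern_le_max p (v i)).trans ?_
      simp
    refine (Real.logb_le_logb_of_le one_lt_two (srcProb_pos hp0 hp1 v) hle).trans ?_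
    rw [Real.logb_pow]
    push_cast
    exact le_rfl
  refine le_trans ?_ (Finset.sum_le_sum fun v _ => h v)
  rw [← Finset.sum_mul, sum_srcProb, one_mul]

omit hp0 hp1 in
lemma mem_lowSet {β : ℝ} {j : Fin (2 ^ m)} :
    j ∈ lowSet p β m ↔ condEntropy p m j < delta β m := by simp [lowSet]

omit hp0 hp1 in
lemma mem_highSet {β : ℝ} {j : Fin (2 ^ m)} :
    j ∈ highSet p β m ↔ 1 - delta β m < condEntropy p m j := by simp [highSet]

omit hp0 hp1 in
lemma mem_midSet {β : ℝ} {j : Fin (2 ^ m)} :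
    j ∈ midSet p β m ↔ j ∉ lowSet p β m ∧ j ∉ highSet p β m := by simp [midSet]

omit hp0 hp1 in
lemma delta_pos (β : ℝ) : 0 < delta β m := Real.rpow_pos_of_pos two_pos _

/-- The low-entropy bits carry at most `n δ` of the block entropy and every other bit at most one.
Hence a linear amount of entropy forces `ñ` to be linear in `n`. -/
lemma compLen_ge (β : ℝ) :
    2 ^ m * (-Real.logb 2 (max p (1 - p)) - delta β m) ≤ (compLen p β m : ℝ) := by
  have h1 := sum_condEntropy_ge hp0 hp1 m
  have h2 : ∑ j, condEntropy p m j ≤ 2 ^ m * delta β m + (compLen p β m : ℝ) := by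
    rw [← Finset.sum_add_sum_compl (lowSet p β m)]
    refine add_le_add ?_ ?_
    · calc _ ≤ ∑ j ∈ lowSet p β m, delta β m :=
            Finset.sum_le_sum fun j hj => (mem_lowSet m |>.1 hj).le
        _ ≤ ∑ j : Fin (2 ^ m), delta β m :=
            Finset.sum_le_sum_of_subset_of_nonneg (Finset.subset_univ _)
              fun _ _ _ => (delta_pos m β).le
        _ = _ := by simp
    · calc _ ≤ ∑ j ∈ (lowSet p β m)ᶜ, (1 : ℝ) :=
            Finset.sum_le_sum fun j _ => condEntropy_le_one hp0 hp1 m j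
        _ = ((lowSet p β m)ᶜ.card : ℝ) := by simp
        _ ≤ _ := by
          rw [compLen]
          norm_cast
          refine (Finset.card_le_card fun j hj => ?_).trans (Finset.card_union_le _ _)
          rw [Finset.mem_union, mem_midSet]
          rw [Finset.mem_compl] at hj
          tauto
  rw [mul_sub]
  linarith

lemma relEnt_refLaw_highSet_le (β : ℝ) :
    relEnt (srcProb p) (refLaw p m (highSet p β m)) ≤ compLen p β m * delta β m := by
  rw [relEnt_refLaw hp0 hp1]
  have hl : Real.log 2 ≤ 1 := by linarith [Real.log_two_lt_d9]
  have h1 : ∑ j ∈ highSet p β m, (1 - condEntropy p m j) ≤ compLen p β m * delta β m := by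
    calc _ ≤ ∑ j ∈ highSet p β m, delta β m :=
          Finset.sum_le_sum fun j hj => by linarith [(mem_highSet m).1 hj]
      _ = ((highSet p β m).card : ℝ) * delta β m := by simp
      _ ≤ _ := by
        refine mul_le_mul_of_nonneg_right ?_ (delta_pos m β).le
        rw [compLen]
        push_cast
        linarith [Nat.cast_nonneg (α := ℝ) (midSet p β m).card]
  have h0 : 0 ≤ ∑ j ∈ highSet p β m, (1 - condEntropy p m j) :=
    Finset.sum_nonneg fun j _ => by linarith [condEntropy_le_one hp0 hp1 m j]
  nlinarith [Real.log_pos one_lt_two]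

end refLaw

/-! ### Successive cancellation -/

/-- Some low-entropy bit of the polarized block is not more likely than its complement, given
the past. -/
def RowFail (p β : ℝ) (m : ℕ) (v : Fin (2 ^ m) → ZMod 2) : Prop :=
  ∃ j ∈ lowSet p β m, condProb p m j (polarize m v) ≤ 1 / 2

/-- A conditional probability `q ≤ 1 / 2` has `- log₂ q ≥ 1`. The failure probability at a
low-entropy index is thus at most the entropy there, which is below `δ`. -/
lemma sum_srcProb_rowFail_le {p : ℝ} (hp0 : 0 < p) (hp1 : p < 1) (β : ℝ) (m : ℕ) :
    ∑ v, srcProb p v * ind (RowFail p β m v) ≤ 2 ^ m * delta β m := by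
  have h : ∀ v : Fin (2 ^ m) → ZMod 2, srcProb p v * ind (RowFail p β m v) ≤
      ∑ j ∈ lowSet p β m, srcProb p v * -Real.logb 2 (condProb p m j (polarize m v)) := by
    intro v
    rw [← Finset.mul_sum]
    refine mul_le_mul_of_nonneg_left ((ind_exists_le _ _).trans
      (Finset.sum_le_sum fun j _ => ?_)) (srcProb_pos hp0 hp1 v).le
    by_cases hj : condProb p m j (polarize m v) ≤ 1 / 2
    · rw [ind_true hj]
      have := Real.logb_le_logb_of_le one_lt_two (condProb_pos hp0 hp1 m j _) hj
      rw [one_div, Real.logb_inv, Real.logb_self_eq_one one_lt_two] at this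
      linarith
    · rw [ind_false hj]
      exact neg_logb_condProb_nonneg hp0 hp1 m j _
  refine (Finset.sum_le_sum fun v _ => h v).trans ?_
  rw [Finset.sum_comm]
  simp_rw [← condEntropy_eq]
  calc _ ≤ ∑ j ∈ lowSet p β m, delta β m :=
        Finset.sum_le_sum fun j hj => (mem_lowSet m |>.1 hj).le
    _ ≤ ∑ j : Fin (2 ^ m), delta β m :=
        Finset.sum_le_sum_of_subset_of_nonneg (Finset.subset_univ _)
          fun _ _ _ => (delta_pos m β).le
    _ = _ := by simp

/-- As long as the estimated prefix is the true one, the decoder compares the true conditional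
probabilities. Without row failure the true bit has more than half of the mass. -/
lemma scSteps_eq {p : ℝ} (hp0 : 0 < p) (hp1 : p < 1) (β : ℝ) (m : ℕ) (v a : Fin (2 ^ m) → ZMod 2)
    (hv : ¬ RowFail p β m v) (ha : ∀ j ∉ lowSet p β m, a j = polarize m v j) (k : ℕ)
    (hk : k ≤ 2 ^ m) :
    ∀ i : Fin (2 ^ m), (i : ℕ) < k → scSteps p β m a k i = polarize m v i := by
  classical
  induction k with
  | zero => intro i hi; omega
  | succ k ih =>
    intro i hi
    have ih' := ih (by omega)
    have hk' : k < 2 ^ m := hk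
    rw [scSteps, dif_pos hk']
    by_cases hik : i = ⟨k, hk'⟩
    · subst hik
      rw [Function.update_self]
      by_cases hl : (⟨k, hk'⟩ : Fin (2 ^ m)) ∈ lowSet p β m
      · rw [if_pos hl]
        have hc : ∀ b, prefixProb p m (k + 1) (Function.update (scSteps p β m a k) ⟨k, hk'⟩ b) =
            prefixProb p m (k + 1) (Function.update (polarize m v) ⟨k, hk'⟩ b) := by
          intro b
          refine prefixProb_congr p m _ fun i hi => ?_
          by_cases hik : i = ⟨k, hk'⟩
          · subst hik; simp
          · have : (i : ℕ) ≠ k := fun h => hik (Fin.ext h)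
            rw [Function.update_of_ne hik, Function.update_of_ne hik, ih' i (by omega)]
        rw [hc, hc]
        have hs := sum_prefixProb_update p m ⟨k, hk'⟩ (polarize m v)
        rw [sum_zmod_two] at hs
        -- The inequality is strict because `RowFail` counts ties as failures, so the tie-breaking
        -- rule of `scSteps` is irrelevant.
        have hq : 1 / 2 < condProb p m ⟨k, hk'⟩ (polarize m v) := by
          by_contra hq
          exact hv ⟨_, hl, not_lt.1 hq⟩
        rw [condProb, lt_div_iff₀ (prefixProb_pos hp0 hp1 _ _ _)] at hq
        have hu := Function.update_eq_self (⟨k, hk'⟩ : Fin (2 ^ m)) (polarize m v)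
        have hb : polarize m v ⟨k, hk'⟩ = 0 ∨ polarize m v ⟨k, hk'⟩ = 1 := by
          generalize polarize m v ⟨k, hk'⟩ = b
          revert b; decide
        rcases hb with hb | hb
        · rw [hb] at hu ⊢
          rw [hu] at hs ⊢
          simp only at hs hq
          rw [if_neg (by linarith)]
        · rw [hb] at hu ⊢
          rw [hu] at hs ⊢
          simp only at hs hq
          rw [if_pos (by linarith)]
      · rw [if_neg hl, ha _ hl]
    · have : (i : ℕ) ≠ k := fun h => hik (Fin.ext h)
      rw [Function.update_of_ne hik, ih' i (by omega)]

lemma srcDecode_srcEncode {p : ℝ} (hp0 : 0 < p) (hp1 : p < 1) (β : ℝ) (m : ℕ) {d : ℕ}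
    (v : Fin (2 ^ m) → ZMod 2) (u : Fin d → ZMod 2) (hv : ¬ RowFail p β m v) :
    srcDecode p β m (srcEncode p β m v u) u = v := by
  conv_rhs => rw [← vecMul_polarize_inv m v]
  unfold srcDecode
  congr 1
  funext i
  refine scSteps_eq hp0 hp1 β m v _ hv (fun j hj => ?_) (2 ^ m) le_rfl i i.2
  by_cases hH : j ∈ highSet p β m
  · simp [hH, srcEncode]
  · have hJ : j ∈ midSet p β m := (mem_midSet m).2 ⟨hj, hH⟩
    simp [hH, hJ, srcEncode]

/-! ### Events about the source and seed matrices under general row laws -/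

/-- Probability of an event about the source and seed matrices when the rows of the source matrix
are independent with laws `ρ i`. -/
def rowProb {n ℓ d : ℕ} (ρ : Fin ℓ → (Fin n → ZMod 2) → ℝ)
    (E : (Fin ℓ → Fin n → ZMod 2) → (Fin ℓ → Fin d → ZMod 2) → Prop) : ℝ :=
  ∑ V, ∑ U, ind (E V U) * ((∏ i, ρ i (V i)) * ((2 : ℝ) ^ (ℓ * d))⁻¹)

lemma prob_eq_rowProb (p : ℝ) {n ℓ d : ℕ}
    (E : (Fin ℓ → Fin n → ZMod 2) → (Fin ℓ → Fin d → ZMod 2) → Prop) :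
    prob p E = rowProb (fun _ => srcProb p) E := by
  unfold prob rowProb ind
  simp

lemma card_seed (ℓ d : ℕ) : (Fintype.card (Fin ℓ → Fin d → ZMod 2) : ℝ) = 2 ^ (ℓ * d) := by
  simp only [Fintype.card_pi, ZMod.card, Finset.prod_const, Finset.card_univ, Fintype.card_fin]
  push_cast
  rw [← pow_mul, mul_comm]

lemma rowProb_of_forall {n ℓ d : ℕ} (ρ : Fin ℓ → (Fin n → ZMod 2) → ℝ)
    (h1 : ∀ i, ∑ x, ρ i x = 1)
    (E : (Fin ℓ → Fin n → ZMod 2) → (Fin ℓ → Fin d → ZMod 2) → Prop) (hE : ∀ V U, E V U) :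
    rowProb ρ E = 1 := by
  unfold rowProb
  simp_rw [ind_true (hE _ _), one_mul, Finset.sum_const, Finset.card_univ, nsmul_eq_mul, card_seed]
  have h : ∀ x : ℝ, (2 : ℝ) ^ (ℓ * d) * (x * ((2 : ℝ) ^ (ℓ * d))⁻¹) = x := fun x => by
    field_simp
  simp_rw [h]
  rw [sum_pi_prod, Finset.prod_eq_one fun i _ => h1 i]

/-- Row laws with the rows in `K` fixed to `v` and the others of law `μ`. -/
def fixRows {n ℓ : ℕ} (μ : (Fin n → ZMod 2) → ℝ) (K : Finset (Fin ℓ))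
    (v : K → Fin n → ZMod 2) (i : Fin ℓ) (x : Fin n → ZMod 2) : ℝ :=
  if h : i ∈ K then ind (x = v ⟨i, h⟩) else μ x

lemma sum_ind_eq_one {X : Type*} [Fintype X] (x : X) : ∑ y, ind (y = x) = 1 := by
  simpa using sum_ind_eq' x (fun _ => 1)

lemma sum_fixRows {n ℓ : ℕ} {μ : (Fin n → ZMod 2) → ℝ} (h1 : ∑ x, μ x = 1) (K : Finset (Fin ℓ))
    (v : K → Fin n → ZMod 2) (i : Fin ℓ) : ∑ x, fixRows μ K v i x = 1 := by
  unfold fixRows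
  by_cases h : i ∈ K
  · simp only [h, dif_pos]; exact sum_ind_eq_one _
  · simpa [h] using h1

lemma fixRows_nonneg {n ℓ : ℕ} {μ : (Fin n → ZMod 2) → ℝ} (h0 : ∀ x, 0 ≤ μ x)
    (K : Finset (Fin ℓ)) (v : K → Fin n → ZMod 2) (i : Fin ℓ) (x : Fin n → ZMod 2) :
    0 ≤ fixRows μ K v i x := by
  unfold fixRows
  split_ifs
  · exact ind_nonneg _
  · exact h0 x

/-- The rows are independent, so conditioning on those in `K` replaces their laws by point masses.
The factor `κ`, the probability of the conditioning event, cancels. -/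
lemma prob_and_div_prob {p : ℝ} (hp0 : 0 < p) (hp1 : p < 1) {n ℓ d : ℕ} (K : Finset (Fin ℓ))
    (v : K → Fin n → ZMod 2)
    (E : (Fin ℓ → Fin n → ZMod 2) → (Fin ℓ → Fin d → ZMod 2) → Prop) :
    prob p (fun V U => E V U ∧ (fun i : K => V i) = v) /
      prob p (n := n) (ℓ := ℓ) (d := d) (fun V _ => (fun i : K => V i) = v) =
      rowProb (fixRows (srcProb p) K v) E := by
  set κ : ℝ := ∏ i : Fin ℓ, if h : i ∈ K then srcProb p (v ⟨i, h⟩) else 1 with hκ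
  have hκ0 : κ ≠ 0 := by
    refine Finset.prod_ne_zero_iff.2 fun i _ => ?_
    split_ifs
    · exact (srcProb_pos hp0 hp1 _).ne'
    · exact one_ne_zero
  have hV : ∀ V : Fin ℓ → Fin n → ZMod 2,
      ind ((fun i : K => V i) = v) * ∏ i, srcProb p (V i) =
        κ * ∏ i, fixRows (srcProb p) K v i (V i) := by
    intro V
    have e : ind ((fun i : K => V i) = v) =
        ∏ i, if h : i ∈ K then ind (V i = v ⟨i, h⟩) else 1 := by
      have : ((fun i : K => V i) = v) = ∀ i, ∀ h : i ∈ K, V i = v ⟨i, h⟩ :=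
        propext ⟨fun h i hi => congrFun h ⟨i, hi⟩, fun h => funext fun i => h i i.2⟩
      rw [this, ind_forall]
      refine Finset.prod_congr rfl fun i _ => ?_
      by_cases hi : i ∈ K
      · simp [hi]
      · simp [hi, ind_true]
    rw [e, hκ, ← Finset.prod_mul_distrib, ← Finset.prod_mul_distrib]
    refine Finset.prod_congr rfl fun i _ => ?_
    unfold fixRows
    by_cases hi : i ∈ K
    · simp only [hi, dif_pos]
      by_cases hv : V i = v ⟨i, hi⟩
      · rw [hv, mul_comm]
      · rw [ind_false hv]; simp
    · simp [hi]
  have hE : ∀ E' : (Fin ℓ → Fin n → ZMod 2) → (Fin ℓ → Fin d → ZMod 2) → Prop,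
      prob p (fun V U => E' V U ∧ (fun i : K => V i) = v) =
        κ * rowProb (fixRows (srcProb p) K v) E' := by
    intro E'
    rw [prob_eq_rowProb, rowProb, rowProb, Finset.mul_sum]
    refine Finset.sum_congr rfl fun V _ => ?_
    rw [Finset.mul_sum]
    refine Finset.sum_congr rfl fun U _ => ?_
    rw [ind_and]
    have := hV V
    linear_combination (ind (E' V U) * ((2 : ℝ) ^ (ℓ * d))⁻¹) * this
  have hT := hE fun _ _ => True
  simp only [true_and] at hT
  rw [hE, hT, rowProb_of_forall _ (sum_fixRows (sum_srcProb p n) K v) _ (fun _ _ => trivial),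
    mul_one, mul_div_cancel_left₀ _ hκ0]

/-- Data processing: no function of source and seed increases the distance between the two source
laws. -/
lemma sum_abs_rowProb_sub_le {n ℓ d : ℕ} (ρ ρ' : Fin ℓ → (Fin n → ZMod 2) → ℝ)
    {Z : Type*} [Fintype Z]
    (T : (Fin ℓ → Fin n → ZMod 2) → (Fin ℓ → Fin d → ZMod 2) → Z) :
    ∑ z, |rowProb ρ (fun V U => T V U = z) - rowProb ρ' (fun V U => T V U = z)| ≤
      ∑ V : Fin ℓ → Fin n → ZMod 2, |∏ i, ρ i (V i) - ∏ i, ρ' i (V i)| := by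
  have h : ∀ z, |rowProb ρ (fun V U => T V U = z) - rowProb ρ' (fun V U => T V U = z)| ≤
      ∑ V : Fin ℓ → Fin n → ZMod 2, ∑ U : Fin ℓ → Fin d → ZMod 2,
        ind (T V U = z) * (|∏ i, ρ i (V i) - ∏ i, ρ' i (V i)| * ((2 : ℝ) ^ (ℓ * d))⁻¹) := by
    intro z
    unfold rowProb
    rw [← Finset.sum_sub_distrib]
    refine (Finset.abs_sum_le_sum_abs _ _).trans (Finset.sum_le_sum fun V _ => ?_)
    rw [← Finset.sum_sub_distrib]
    refine (Finset.abs_sum_le_sum_abs _ _).trans (Finset.sum_le_sum fun U _ => le_of_eq ?_)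
    rw [← mul_sub, ← sub_mul, abs_mul, abs_mul, abs_of_nonneg (ind_nonneg _),
      abs_of_pos (a := ((2 : ℝ) ^ (ℓ * d))⁻¹) (by positivity)]
  refine (Finset.sum_le_sum fun z _ => h z).trans (le_of_eq ?_)
  rw [Finset.sum_comm]
  refine Finset.sum_congr rfl fun V _ => ?_
  rw [Finset.sum_comm]
  simp_rw [sum_ind_eq]
  rw [Finset.sum_const, Finset.card_univ, nsmul_eq_mul, card_seed]
  field_simp

/-- Pinsker's inequality for the whole source matrix. The fixed rows contribute no relative entropy
and each of the others at most `ñ δ`. -/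
lemma sum_abs_rowProb_fixRows_sub_le {p : ℝ} (hp0 : 0 < p) (hp1 : p < 1) (β : ℝ) (m : ℕ)
    {ℓ d : ℕ} (K : Finset (Fin ℓ)) (v : K → Fin (2 ^ m) → ZMod 2) {Z : Type*} [Fintype Z]
    (T : (Fin ℓ → Fin (2 ^ m) → ZMod 2) → (Fin ℓ → Fin d → ZMod 2) → Z) :
    ∑ z, |rowProb (fixRows (srcProb p) K v) (fun V U => T V U = z) -
      rowProb (fixRows (refLaw p m (highSet p β m)) K v) (fun V U => T V U = z)| ≤
      √(2 * (compLen p β m : ℝ) * (ℓ : ℝ) * delta β m) := by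
  refine (sum_abs_rowProb_sub_le _ _ T).trans (Real.le_sqrt_of_sq_le ?_)
  set r := refLaw p m (highSet p β m)
  have hr : ∀ x, 0 < r x := refLaw_pos hp0 hp1 m _
  have hz : ∀ i x, fixRows r K v i x = 0 → fixRows (srcProb p) K v i x = 0 := by
    intro i x
    unfold fixRows
    split_ifs
    · exact id
    · exact fun h => absurd h (hr x).ne'
  have s1 := sum_fixRows (sum_srcProb p (2 ^ m)) K v
  have s2 := sum_fixRows (sum_refLaw hp0 hp1 m (highSet p β m)) K v
  have n1 := fixRows_nonneg (fun x => (srcProb_pos hp0 hp1 x).le) K v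
  have n2 := fixRows_nonneg (fun x => (hr x).le) K v
  have hP := sq_sum_abs_sub_le_relEnt
    (fun V : Fin ℓ → Fin (2 ^ m) → ZMod 2 => ∏ i, fixRows (srcProb p) K v i (V i))
    (fun V => ∏ i, fixRows r K v i (V i))
    (fun V => Finset.prod_nonneg fun i _ => n1 i _) (fun V => Finset.prod_nonneg fun i _ => n2 i _)
    (by rw [sum_pi_prod, Finset.prod_eq_one fun i _ => s1 i])
    (by rw [sum_pi_prod, Finset.prod_eq_one fun i _ => s2 i])
    (fun V hV => by
      obtain ⟨i, _, hi⟩ := Finset.prod_eq_zero_iff.1 hV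
      exact Finset.prod_eq_zero (Finset.mem_univ i) (hz i _ hi))
  refine hP.trans ?_
  rw [relEnt_pi _ _ s1 hz]
  have hrow : ∀ i, relEnt (fixRows (srcProb p) K v i) (fixRows r K v i) ≤
      compLen p β m * delta β m := by
    intro i
    by_cases hi : i ∈ K
    · have : relEnt (fixRows (srcProb p) K v i) (fixRows r K v i) = 0 := by
        unfold relEnt fixRows
        refine Finset.sum_eq_zero fun x _ => ?_
        simp only [hi, dif_pos]
        by_cases hx : x = v ⟨i, hi⟩
        · rw [ind_true hx]; simp
        · rw [ind_false hx]; simp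
      rw [this]
      exact mul_nonneg (Nat.cast_nonneg _) (delta_pos m β).le
    · have e : ∀ μ : (Fin (2 ^ m) → ZMod 2) → ℝ, fixRows μ K v i = μ := fun μ => by
        funext x; simp [fixRows, hi]
      rw [e, e]
      exact relEnt_refLaw_highSet_le hp0 hp1 m β
  have := Finset.sum_le_sum fun i (_ : i ∈ Finset.univ) => hrow i
  rw [Finset.sum_const, Finset.card_univ, Fintype.card_fin, nsmul_eq_mul] at this
  linarith

/-! ### The observed columns under the reference law -/

/-- The law of one bit of a column whose bits in `K` are fixed to `a`. -/
def colBit {ℓ : ℕ} (K : Finset (Fin ℓ)) (a : K → ZMod 2) (i : Fin ℓ) (b : ZMod 2) : ℝ :=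
  if h : i ∈ K then ind (b = a ⟨i, h⟩) else 1 / 2

/-- The law of the encoded bits in `W` of a column whose bits in `K` are fixed to `a`, the others
being fair. -/
def colLaw {ℓ : ℕ} (f : (Fin ℓ → ZMod 2) → Fin ℓ → ZMod 2) (W K : Finset (Fin ℓ))
    (a : K → ZMod 2) (z : W → ZMod 2) : ℝ :=
  ∑ x : Fin ℓ → ZMod 2, (∏ i, colBit K a i (x i)) * ind ((fun i : W => f x i) = z)

/-- Leakage of one column: distance between the law of its observed bits given those in `K` and
their unconditional law. -/
def colDist {ℓ : ℕ} (f : (Fin ℓ → ZMod 2) → Fin ℓ → ZMod 2) (W K : Finset (Fin ℓ))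
    (a : K → ZMod 2) : ℝ :=
  ∑ z, |colLaw f W K a z - colLaw f W ∅ (fun _ => 0) z|

lemma colBit_nonneg {ℓ : ℕ} (K : Finset (Fin ℓ)) (a : K → ZMod 2) (i : Fin ℓ) (b : ZMod 2) :
    0 ≤ colBit K a i b := by
  unfold colBit
  split_ifs
  · exact ind_nonneg _
  · norm_num

lemma sum_colBit {ℓ : ℕ} (K : Finset (Fin ℓ)) (a : K → ZMod 2) (i : Fin ℓ) :
    ∑ b, colBit K a i b = 1 := by
  unfold colBit
  by_cases h : i ∈ K
  · simp only [h, dif_pos]; exact sum_ind_eq_one _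
  · simp only [h]; rw [sum_zmod_two]; norm_num

lemma colLaw_nonneg {ℓ : ℕ} (f : (Fin ℓ → ZMod 2) → Fin ℓ → ZMod 2) (W K : Finset (Fin ℓ))
    (a : K → ZMod 2) (z : W → ZMod 2) : 0 ≤ colLaw f W K a z :=
  Finset.sum_nonneg fun _ _ => mul_nonneg (Finset.prod_nonneg fun _ _ => colBit_nonneg _ _ _ _)
    (ind_nonneg _)

lemma sum_colLaw {ℓ : ℕ} (f : (Fin ℓ → ZMod 2) → Fin ℓ → ZMod 2) (W K : Finset (Fin ℓ))
    (a : K → ZMod 2) : ∑ z, colLaw f W K a z = 1 := by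
  unfold colLaw
  rw [Finset.sum_comm]
  simp_rw [← Finset.mul_sum]
  have : ∀ x : Fin ℓ → ZMod 2, ∑ z : W → ZMod 2, ind ((fun i : W => f x i) = z) = 1 := fun x => by
    simpa using sum_ind_eq (fun i : W => f x i) (fun _ => 1)
  simp_rw [this, mul_one]
  rw [sum_pi_prod, Finset.prod_eq_one fun i _ => sum_colBit K a i]

/-- The law of one bit of the compressed matrix, in the rows fixed to `v` or under the reference
law. -/
def cellLaw (p β : ℝ) (m : ℕ) {ℓ : ℕ} (K : Finset (Fin ℓ)) (v : K → Fin (2 ^ m) → ZMod 2)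
    (j : Cols p β m) (i : Fin ℓ) (b : ZMod 2) : ℝ :=
  Sum.elim (fun j => colBit K (fun i => polarize m (v i) j.1) i b) (fun _ => 1 / 2) j

/-- Distinct positions of a uniform seed hold independent fair bits. The indicator is regrouped by
seed position, so that the sum over the seed factorizes. -/
lemma sum_ind_seed {J : Type*} [Fintype J] {d : ℕ} (e : J → Fin d)
    (he : Function.Injective e) (c : J → ZMod 2) :
    ∑ u : Fin d → ZMod 2, ((2 : ℝ) ^ d)⁻¹ * ind (∀ j, u (e j) = c j) =
      (1 / 2) ^ Fintype.card J := by
  classical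
  have h1 : ∀ u : Fin d → ZMod 2, ((2 : ℝ) ^ d)⁻¹ * ind (∀ j, u (e j) = c j) =
      ∏ k, (1 / 2 * ∏ j, if e j = k then ind (u k = c j) else 1) := by
    intro u
    rw [Finset.prod_mul_distrib, ind_forall, Finset.prod_comm]
    simp
  simp_rw [h1]
  rw [sum_pi_prod (fun k b => (1 / 2 * ∏ j, if e j = k then ind (b = c j) else 1 : ℝ))]
  have h2 : ∀ k : Fin d, ∑ b, (1 / 2 * ∏ j, if e j = k then ind (b = c j) else 1 : ℝ) =
      ∏ j, if e j = k then 1 / 2 else 1 := by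
    intro k
    rw [← Finset.mul_sum]
    by_cases hk : ∃ j, e j = k
    · obtain ⟨j, rfl⟩ := hk
      simp only [he.eq_iff, Finset.prod_ite_eq', Finset.mem_univ, if_true]
      rw [sum_ind_eq_one, mul_one]
    · push Not at hk
      simp only [hk, if_false, Finset.prod_const_one]
      rw [sum_zmod_two]; norm_num
  simp_rw [h2]
  rw [Finset.prod_comm]
  simp

/-- The one-time pad: whatever the row `v`, the padded bits are uniform, as each index of `midSet`
uses its own seed bit, namely its rank, which is below `d`. -/
lemma sum_ind_srcEncode (p β : ℝ) (m : ℕ) {d : ℕ} (hd : (midSet p β m).card ≤ d)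
    (v : Fin (2 ^ m) → ZMod 2) (x : Cols p β m → ZMod 2) :
    ∑ u : Fin d → ZMod 2, ((2 : ℝ) ^ d)⁻¹ * ind (srcEncode p β m v u = x) =
      ind (∀ j : highSet p β m, polarize m v j.1 = x (Sum.inl j)) *
        (1 / 2) ^ (midSet p β m).card := by
  have hlt : ∀ j : midSet p β m, ((midSet p β m).filter (· < j.1)).card < d := by
    intro j
    have h : (midSet p β m).filter (· < j.1) ⊂ midSet p β m :=
      Finset.filter_ssubset.2 ⟨j.1, j.2, lt_irrefl _⟩
    exact (Finset.card_lt_card h).trans_le hd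
  have hmono : ∀ j k : midSet p β m, j.1 < k.1 → ((midSet p β m).filter (· < j.1)).card <
      ((midSet p β m).filter (· < k.1)).card := by
    intro j k hjk
    refine Finset.card_lt_card (Finset.ssubset_iff_of_subset (fun i hi => ?_) |>.2
      ⟨j.1, by simp [hjk], by simp⟩)
    rw [Finset.mem_filter] at hi ⊢
    exact ⟨hi.1, hi.2.trans hjk⟩
  have hinj : Function.Injective fun j : midSet p β m =>
      (⟨((midSet p β m).filter (· < j.1)).card, hlt j⟩ : Fin d) := by
    intro j k hjk
    have hjk' := Fin.mk.inj_iff.1 hjk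
    rcases lt_trichotomy j.1 k.1 with h | h | h
    · exact absurd hjk' (hmono j k h).ne
    · exact Subtype.ext h
    · exact absurd hjk' (hmono k j h).ne'
  have hs := sum_ind_seed _ hinj (fun j => x (Sum.inr j) - polarize m v j.1)
  rw [Fintype.card_coe] at hs
  rw [← hs, Finset.mul_sum]
  refine Finset.sum_congr rfl fun u _ => ?_
  rw [mul_left_comm, ← ind_and]
  congr 2
  refine propext ⟨fun h => ⟨fun j => congrFun h (Sum.inl j), fun j => ?_⟩, fun h => ?_⟩
  · have := congrFun h (Sum.inr j)
    simp only [srcEncode, Sum.elim_inr, padBit, hlt j, dif_pos] at this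
    rw [← this]; ring
  · funext j
    rcases j with j | j
    · exact h.1 j
    · simp only [srcEncode, Sum.elim_inr, padBit, hlt j, dif_pos]
      rw [h.2 j]; ring

/-- A compressed row has independent cells under the reference law. The cells in `midSet` are fair
by the pad; those in `highSet` are fixed for a known row and fair by `sum_refLaw_mul_ind` otherwise.
-/
lemma sum_fixRows_srcEncode {p : ℝ} (hp0 : 0 < p) (hp1 : p < 1) (β : ℝ) (m : ℕ) {ℓ d : ℕ}
    (hd : (midSet p β m).card ≤ d) (K : Finset (Fin ℓ)) (v : K → Fin (2 ^ m) → ZMod 2)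
    (i : Fin ℓ) (x : Cols p β m → ZMod 2) :
    ∑ y, ∑ u : Fin d → ZMod 2, fixRows (refLaw p m (highSet p β m)) K v i y *
      (((2 : ℝ) ^ d)⁻¹ * ind (srcEncode p β m y u = x)) = ∏ j, cellLaw p β m K v j i (x j) := by
  rw [Finset.sum_congr rfl fun y _ => (Finset.mul_sum _ _ _).symm]
  simp_rw [sum_ind_srcEncode p β m hd]
  rw [Fintype.prod_sum_type]
  simp only [cellLaw, Sum.elim_inl, Sum.elim_inr, Finset.prod_const, Finset.card_univ,
    Fintype.card_coe]
  simp_rw [← mul_assoc]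
  rw [← Finset.sum_mul]
  congr 1
  unfold fixRows colBit
  by_cases hi : i ∈ K
  · simp only [hi, dif_pos]
    rw [sum_ind_eq', ind_forall]
    refine Finset.prod_congr rfl fun j _ => ?_
    simp only [eq_comm]
  · simp only [hi, dif_neg, not_false_eq_true, Finset.prod_const, Finset.card_univ,
      Fintype.card_coe]
    rw [← sum_refLaw_mul_ind hp0 hp1 m (highSet p β m)
      (fun j => if h : j ∈ highSet p β m then x (Sum.inl ⟨j, h⟩) else 0)]
    refine Finset.sum_congr rfl fun y _ => ?_
    congr 2
    refine propext ⟨fun h j hj => ?_, fun h j => ?_⟩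
    · rw [dif_pos hj]; exact h ⟨j, hj⟩
    · have := h j.1 j.2
      rwa [dif_pos j.2] at this

/-- All cells of the compressed matrix are independent, so its columns are too. As each column is
encoded separately, the law of the observation factorizes over columns. -/
lemma rowProb_transmit {p : ℝ} (hp0 : 0 < p) (hp1 : p < 1) (β : ℝ) (m : ℕ) {ℓ ks d : ℕ}
    (hd : (midSet p β m).card ≤ d) (C : Codebook ℓ ks) (W K : Finset (Fin ℓ))
    (v : K → Fin (2 ^ m) → ZMod 2) (z : W → Cols p β m → ZMod 2) :
    rowProb (d := d) (fixRows (refLaw p m (highSet p β m)) K v)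
      (fun V U => (fun i : W => transmit p β m C V U i) = z) =
      ∏ j, ∑ x : Fin ℓ → ZMod 2, (∏ i, cellLaw p β m K v j i (x i)) *
        ind ((fun i : W => chEncode C x i) = fun i => z i j) := by
  set ρ := fixRows (refLaw p m (highSet p β m)) K v
  set T : (Fin ℓ → Cols p β m → ZMod 2) → W → Cols p β m → ZMod 2 :=
    fun M i j => chEncode C (fun i' => M i' j) i with hT
  have h1 : ∀ (V : Fin ℓ → Fin (2 ^ m) → ZMod 2) (U : Fin ℓ → Fin d → ZMod 2),
      ind ((fun i : W => transmit p β m C V U i) = z) *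
        ((∏ i, ρ i (V i)) * ((2 : ℝ) ^ (ℓ * d))⁻¹) =
      ∑ M : Fin ℓ → Cols p β m → ZMod 2, ind (T M = z) *
        ∏ i, ρ i (V i) * (((2 : ℝ) ^ d)⁻¹ * ind (srcEncode p β m (V i) (U i) = M i)) := by
    intro V U
    simp_rw [Finset.prod_mul_distrib, ← ind_forall]
    rw [Finset.prod_const, Finset.card_univ, Fintype.card_fin, inv_pow, ← pow_mul, mul_comm d ℓ]
    have := sum_ind_eq (fun i => srcEncode p β m (V i) (U i))
      (fun M => ind (T M = z) * ((∏ i, ρ i (V i)) * ((2 : ℝ) ^ (ℓ * d))⁻¹))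
    rw [show (fun i : W => transmit p β m C V U i) = T fun i => srcEncode p β m (V i) (U i)
      from rfl, ← this]
    refine Finset.sum_congr rfl fun M _ => ?_
    rw [show ((fun i => srcEncode p β m (V i) (U i)) = M) =
      ∀ i, srcEncode p β m (V i) (U i) = M i from propext funext_iff]
    ring
  have h2 : ∀ M : Fin ℓ → Cols p β m → ZMod 2,
      ∑ V : Fin ℓ → Fin (2 ^ m) → ZMod 2, ∑ U : Fin ℓ → Fin d → ZMod 2,
        ∏ i, ρ i (V i) * (((2 : ℝ) ^ d)⁻¹ * ind (srcEncode p β m (V i) (U i) = M i)) =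
      ∏ i, ∏ j, cellLaw p β m K v j i (M i j) := by
    intro M
    have : ∀ V : Fin ℓ → Fin (2 ^ m) → ZMod 2, ∑ U : Fin ℓ → Fin d → ZMod 2,
        ∏ i, ρ i (V i) * (((2 : ℝ) ^ d)⁻¹ * ind (srcEncode p β m (V i) (U i) = M i)) =
        ∏ i, ∑ u : Fin d → ZMod 2,
          ρ i (V i) * (((2 : ℝ) ^ d)⁻¹ * ind (srcEncode p β m (V i) u = M i)) := fun V =>
      sum_pi_prod (fun i u =>
        ρ i (V i) * (((2 : ℝ) ^ d)⁻¹ * ind (srcEncode p β m (V i) u = M i)))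
    simp_rw [this]
    rw [sum_pi_prod (fun i y => ∑ u : Fin d → ZMod 2,
          ρ i y * (((2 : ℝ) ^ d)⁻¹ * ind (srcEncode p β m y u = M i)))]
    exact Finset.prod_congr rfl fun i _ => sum_fixRows_srcEncode hp0 hp1 β m hd K v i (M i)
  unfold rowProb
  simp_rw [h1]
  have h3 : ∑ V : Fin ℓ → Fin (2 ^ m) → ZMod 2, ∑ U : Fin ℓ → Fin d → ZMod 2,
      ∑ M : Fin ℓ → Cols p β m → ZMod 2, ind (T M = z) *
        ∏ i, ρ i (V i) * (((2 : ℝ) ^ d)⁻¹ * ind (srcEncode p β m (V i) (U i) = M i)) =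
      ∑ M : Fin ℓ → Cols p β m → ZMod 2, ind (T M = z) *
        ∏ i, ∏ j, cellLaw p β m K v j i (M i j) := by
    simp_rw [← h2, Finset.mul_sum]
    rw [Finset.sum_comm (s := (Finset.univ : Finset (Fin ℓ → Cols p β m → ZMod 2)))]
    exact Finset.sum_congr rfl fun V _ => Finset.sum_comm
  -- Transposition: the sum over matrices listed by rows becomes a sum over families of columns,
  -- which factorizes.
  rw [h3, ← sum_pi_prod (fun j x => (∏ i, cellLaw p β m K v j i (x i)) *
        ind ((fun i : W => chEncode C x i) = fun i => z i j)),
    ← Equiv.sum_comp (Equiv.piComm fun (_ : Fin ℓ) (_ : Cols p β m) => ZMod 2)]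
  refine Finset.sum_congr rfl fun M _ => ?_
  rw [Finset.prod_mul_distrib, ← ind_forall, mul_comm, Finset.prod_comm]
  congr 2
  refine propext ⟨fun h j => funext fun i => congrFun (congrFun h i) j,
    fun h => funext fun i => funext fun j => congrFun (h j) i⟩

/-- Triangle inequality through the two reference laws, with and without the known rows; the
unconditional law is the case `K = ∅`. Between the reference laws the product bound applies, and the
padded columns contribute nothing because their laws agree. -/
lemma leakage_le {p : ℝ} (hp0 : 0 < p) (hp1 : p < 1) (β : ℝ) (m : ℕ) {ℓ ks d : ℕ}
    (hd : (midSet p β m).card ≤ d) (C : Codebook ℓ ks) (W K : Finset (Fin ℓ))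
    (v : K → Fin (2 ^ m) → ZMod 2) :
    leakage p β m d C W K v ≤
      ∑ j : highSet p β m, colDist (chEncode C) W K (fun i => polarize m (v i) j.1) +
        2 * √(2 * (compLen p β m : ℝ) * (ℓ : ℝ) * delta β m) := by
  set v₀ : (∅ : Finset (Fin ℓ)) → Fin (2 ^ m) → ZMod 2 := fun _ => 0
  set r := refLaw p m (highSet p β m)
  set T : (Fin ℓ → Fin (2 ^ m) → ZMod 2) → (Fin ℓ → Fin d → ZMod 2) → W → Cols p β m → ZMod 2 :=
    fun V U i => transmit p β m C V U i
  have h0 : (fun _ : Fin ℓ => srcProb p (n := 2 ^ m)) = fixRows (srcProb p) ∅ v₀ := by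
    funext i x; simp [fixRows]
  have e1 := sum_abs_rowProb_fixRows_sub_le hp0 hp1 β m K v T
  have e2 := sum_abs_rowProb_fixRows_sub_le hp0 hp1 β m ∅ v₀ T
  have e3 : ∑ z, |rowProb (fixRows r K v) (fun V U => T V U = z) -
      rowProb (fixRows r ∅ v₀) (fun V U => T V U = z)| ≤
      ∑ j : highSet p β m, colDist (chEncode C) W K (fun i => polarize m (v i) j.1) := by
    have hl : ∀ (K' : Finset (Fin ℓ)) (v' : K' → Fin (2 ^ m) → ZMod 2) (j : Cols p β m)
        (y : W → ZMod 2), ∑ x : Fin ℓ → ZMod 2, (∏ i, cellLaw p β m K' v' j i (x i)) *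
        ind ((fun i : W => chEncode C x i) = y) =
        Sum.elim (fun j => colLaw (chEncode C) W K' (fun i => polarize m (v' i) j.1) y)
          (fun _ => colLaw (chEncode C) W ∅ (fun _ => 0) y) j := by
      intro K' v' j y
      rcases j with j | j
      · rfl
      · simp [cellLaw, colLaw, colBit]
    set F : (K' : Finset (Fin ℓ)) → (K' → Fin (2 ^ m) → ZMod 2) → Cols p β m →
      (W → ZMod 2) → ℝ := fun K' v' j y =>
        Sum.elim (fun j => colLaw (chEncode C) W K' (fun i => polarize m (v' i) j.1) y)
          (fun _ => colLaw (chEncode C) W ∅ (fun _ => 0) y) j with hF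
    have F0 : ∀ K' v' j y, 0 ≤ F K' v' j y := by
      intro K' v' j y
      rcases j with j | j <;> exact colLaw_nonneg _ _ _ _ _
    have F1 : ∀ K' v' j, ∑ y, F K' v' j y = 1 := by
      intro K' v' j
      rcases j with j | j <;> exact sum_colLaw _ _ _ _
    have ht : ∀ K' v' z, rowProb (fixRows r K' v') (fun V U => T V U = z) =
        ∏ j, F K' v' j (fun i => z i j) := by
      intro K' v' z
      rw [rowProb_transmit hp0 hp1 β m hd]
      exact Finset.prod_congr rfl fun j _ => hl K' v' j _
    simp_rw [ht]
    have hp := sum_abs_prod_sub_prod_le (F K v) (F ∅ v₀) (F0 K v) (F0 ∅ v₀) (F1 K v) (F1 ∅ v₀)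
    rw [← Equiv.sum_comp (Equiv.piComm fun (_ : W) (_ : Cols p β m) => ZMod 2),
      Fintype.sum_sum_type] at hp
    refine hp.trans (le_of_eq ?_)
    simp only [hF, Sum.elim_inl, Sum.elim_inr, sub_self, abs_zero, Finset.sum_const_zero, add_zero]
    refine Finset.sum_congr rfl fun j _ => Finset.sum_congr rfl fun y _ => ?_
    rw [Subsingleton.elim (fun i : (∅ : Finset (Fin ℓ)) => polarize m (v₀ i) j.1) fun _ => 0]
  have hle : leakage p β m d C W K v = ∑ z,
      |rowProb (fixRows (srcProb p) K v) (fun V U => T V U = z) -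
        rowProb (fixRows (srcProb p) ∅ v₀) (fun V U => T V U = z)| := by
    unfold leakage
    refine Finset.sum_congr rfl fun z _ => ?_
    rw [prob_and_div_prob hp0 hp1, prob_eq_rowProb, h0]
  rw [hle]
  calc _ ≤ ∑ z, (|rowProb (fixRows (srcProb p) K v) (fun V U => T V U = z) -
            rowProb (fixRows r K v) (fun V U => T V U = z)| +
          |rowProb (fixRows r K v) (fun V U => T V U = z) -
            rowProb (fixRows r ∅ v₀) (fun V U => T V U = z)| +
          |rowProb (fixRows (srcProb p) ∅ v₀) (fun V U => T V U = z) -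
            rowProb (fixRows r ∅ v₀) (fun V U => T V U = z)|) := by
        refine Finset.sum_le_sum fun z _ => ?_
        generalize rowProb (fixRows (srcProb p) K v) (fun V U => T V U = z) = A
        generalize rowProb (fixRows r K v) (fun V U => T V U = z) = B
        generalize rowProb (fixRows (srcProb p) ∅ v₀) (fun V U => T V U = z) = A'
        generalize rowProb (fixRows r ∅ v₀) (fun V U => T V U = z) = B'
        have h1 := abs_sub_le A B A'
        have h2 := abs_sub_le B B' A'
        rw [abs_sub_comm B' A'] at h2
        linarith
    _ ≤ _ := by
      rw [Finset.sum_add_distrib, Finset.sum_add_distrib]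
      linarith

/-! ### Codebooks as maps, and the error probability of injective ones -/

/-- A column put together from its first `ks` bits and the others. -/
def joinBits {ℓ ks : ℕ} (b : {i : Fin ℓ // (i : ℕ) < ks} → ZMod 2)
    (c : {i : Fin ℓ // ¬ (i : ℕ) < ks} → ZMod 2) (i : Fin ℓ) : ZMod 2 :=
  if hi : (i : ℕ) < ks then b ⟨i, hi⟩ else c ⟨i, hi⟩

lemma chEncode_joinBits {ℓ ks : ℕ} (C : Codebook ℓ ks)
    (b : {i : Fin ℓ // (i : ℕ) < ks} → ZMod 2) (c : {i : Fin ℓ // ¬ (i : ℕ) < ks} → ZMod 2) :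
    chEncode C (joinBits b c) = C b c := by
  have h1 : (fun i : {i : Fin ℓ // (i : ℕ) < ks} => joinBits b c i.1) = b := by
    funext i; simp [joinBits, i.2]
  have h2 : (fun i : {i : Fin ℓ // ¬ (i : ℕ) < ks} => joinBits b c i.1) = c := by
    funext i
    have := i.2
    simp only [joinBits, dif_neg this]
  rw [chEncode, h1, h2]

/-- Codebooks correspond to maps from columns to codewords. -/
def codebookEquiv (ℓ ks : ℕ) : Codebook ℓ ks ≃ ((Fin ℓ → ZMod 2) → Fin ℓ → ZMod 2) where
  toFun := chEncode
  invFun f b c := f (joinBits b c)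
  left_inv C := by funext b c; exact chEncode_joinBits C b c
  right_inv f := by
    funext x
    simp only [chEncode]
    congr 1
    funext i
    simp [joinBits]

lemma chDecode_chEncode {ℓ ks : ℕ} (C : Codebook ℓ ks) (hC : Function.Injective (chEncode C))
    (x : Fin ℓ → ZMod 2) : chDecode C (chEncode C x) = some x := by
  have hu : ∃! be : ({i : Fin ℓ // (i : ℕ) < ks} → ZMod 2) ×
      ({i : Fin ℓ // ¬ (i : ℕ) < ks} → ZMod 2), C be.1 be.2 = chEncode C x := by
    refine ⟨(fun i => x i.1, fun i => x i.1), rfl, ?_⟩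
    rintro ⟨b, c⟩ h
    simp only at h
    rw [← chEncode_joinBits C b c] at h
    have hx := hC h
    subst hx
    refine Prod.ext (funext fun i => ?_) (funext fun i => ?_)
    · simp [joinBits, i.2]
    · have := i.2
      simp only [joinBits, dif_neg this]
  unfold chDecode
  rw [dif_pos hu]
  exact congrArg some (hC ((chEncode_joinBits C _ _).trans hu.choose_spec.1))

lemma bobDecode_transmit {p : ℝ} (hp0 : 0 < p) (hp1 : p < 1) (β : ℝ) (m : ℕ) {ℓ ks d : ℕ}
    (C : Codebook ℓ ks) (hC : Function.Injective (chEncode C))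
    (V : Fin ℓ → Fin (2 ^ m) → ZMod 2) (U : Fin ℓ → Fin d → ZMod 2)
    (hV : ∀ i, ¬ RowFail p β m (V i)) :
    bobDecode p β m C (transmit p β m C V U) U = some V := by
  have h : ∀ j, chDecode C (fun i => transmit p β m C V U i j) =
      some fun i => srcEncode p β m (V i) (U i) j := fun j => chDecode_chEncode C hC _
  have h' : ∀ j, (chDecode C (fun i => transmit p β m C V U i j)).isSome := fun j => by simp [h]
  unfold bobDecode
  rw [dif_pos h']
  have hg : ∀ j, (chDecode C (fun i => transmit p β m C V U i j)).get (h' j) =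
      fun i => srcEncode p β m (V i) (U i) j := fun j =>
    Option.some_injective _ ((Option.some_get _).trans (h j))
  refine congrArg some (funext fun i => ?_)
  simp_rw [hg]
  exact srcDecode_srcEncode hp0 hp1 β m (V i) (U i) (hV i)

/-- With distinct codewords every column is decoded correctly. Only a row failure can cause an
error, and the union bound runs over the `ℓ` rows. -/
lemma errorProb_le {p : ℝ} (hp0 : 0 < p) (hp1 : p < 1) (β : ℝ) (m : ℕ) {ℓ ks : ℕ} (d : ℕ)
    (C : Codebook ℓ ks) (hC : Function.Injective (chEncode C)) :
    errorProb p β m d C ≤ ℓ * (2 ^ m * delta β m) := by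
  unfold errorProb
  rw [prob_eq_rowProb]
  have h1 : ∀ (V : Fin ℓ → Fin (2 ^ m) → ZMod 2) (U : Fin ℓ → Fin d → ZMod 2),
      ind (bobDecode p β m C (transmit p β m C V U) U ≠ some V) ≤
        ∑ i, ind (RowFail p β m (V i)) := by
    intro V U
    refine (ind_mono fun h => ?_).trans
      (ind_exists_le Finset.univ fun i => RowFail p β m (V i))
    by_contra hn
    push Not at hn
    exact h (bobDecode_transmit hp0 hp1 β m C hC V U fun i => hn i (Finset.mem_univ i))
  calc _ ≤ ∑ V : Fin ℓ → Fin (2 ^ m) → ZMod 2, ∑ U : Fin ℓ → Fin d → ZMod 2,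
        (∑ i, ind (RowFail p β m (V i))) * ((∏ i, srcProb p (V i)) * ((2 : ℝ) ^ (ℓ * d))⁻¹) :=
        Finset.sum_le_sum fun V _ => Finset.sum_le_sum fun U _ =>
          mul_le_mul_of_nonneg_right (h1 V U) (mul_nonneg
            (Finset.prod_nonneg fun i _ => (srcProb_pos hp0 hp1 _).le) (by positivity))
    _ = ∑ i, ∑ V : Fin ℓ → Fin (2 ^ m) → ZMod 2,
        (∏ i, srcProb p (V i)) * ind (RowFail p β m (V i)) := by
      rw [Finset.sum_comm (s := (Finset.univ : Finset (Fin ℓ)))]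
      refine Finset.sum_congr rfl fun V _ => ?_
      rw [Finset.sum_const, Finset.card_univ, nsmul_eq_mul, card_seed, ← Finset.mul_sum]
      field_simp
    _ = ∑ _i : Fin ℓ, ∑ v, srcProb p v * ind (RowFail p β m v) :=
      Finset.sum_congr rfl fun i _ => sum_prod_mul_apply (fun _ => srcProb p)
        (fun _ => sum_srcProb p _) i (fun v => ind (RowFail p β m v))
    _ ≤ ∑ _i : Fin ℓ, (2 ^ m * delta β m) :=
      Finset.sum_le_sum fun _ _ => sum_srcProb_rowFail_le hp0 hp1 β m
    _ = _ := by simp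

/-! ### The mean leakage of a column under a uniformly random map -/

lemma prod_colBit {ℓ : ℕ} (K : Finset (Fin ℓ)) (a : K → ZMod 2) (x : Fin ℓ → ZMod 2) :
    ∏ i, colBit K a i (x i) = ind ((fun i : K => x i) = a) * (1 / 2) ^ (ℓ - K.card) := by
  have e : ((fun i : K => x i) = a) = ∀ i, ∀ h : i ∈ K, x i = a ⟨i, h⟩ :=
    propext ⟨fun h i hi => congrFun h ⟨i, hi⟩, fun h => funext fun i => h i i.2⟩
  have e2 : (1 / 2 : ℝ) ^ (ℓ - K.card) = ∏ i : Fin ℓ, if i ∈ Kᶜ then 1 / 2 else 1 := by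
    rw [Finset.prod_ite_mem, Finset.univ_inter, Finset.prod_const, Finset.card_compl,
      Fintype.card_fin]
  rw [e, ind_forall, e2, ← Finset.prod_mul_distrib]
  refine Finset.prod_congr rfl fun i _ => ?_
  by_cases hi : i ∈ K <;> simp [colBit, hi, ind_true]

lemma sum_ind_restrict {ℓ : ℕ} (K : Finset (Fin ℓ)) (a : K → ZMod 2) :
    ∑ x : Fin ℓ → ZMod 2, ind ((fun i : K => x i) = a) = 2 ^ (ℓ - K.card) := by
  have h : ∑ x : Fin ℓ → ZMod 2, ∏ i, colBit K a i (x i) = 1 := by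
    rw [sum_pi_prod, Finset.prod_eq_one fun i _ => sum_colBit K a i]
  simp_rw [prod_colBit] at h
  rw [← Finset.sum_mul, one_div, inv_pow] at h
  exact eq_of_div_eq_one h

lemma sum_comp_eval {X Y : Type*} [Fintype X] [DecidableEq X] [Fintype Y] (φ : Y → ℝ) (x : X) :
    Fintype.card Y * ∑ f : X → Y, φ (f x) = Fintype.card (X → Y) * ∑ y, φ y := by
  rw [← sum_sum_update (fun f : X → Y => φ (f x)) x]
  simp

/-- The values of a uniformly random map at distinct points are independent and `η` is centred, so
the cross terms vanish and only the diagonal remains. -/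
lemma sum_sq_sum_mul_comp {X Y : Type*} [Fintype X] [DecidableEq X] [Fintype Y] [Nonempty Y]
    (α : X → ℝ) (η : Y → ℝ) (hη : ∑ y, η y = 0) :
    Fintype.card Y * ∑ f : X → Y, (∑ x, α x * η (f x)) ^ 2 =
      Fintype.card (X → Y) * ((∑ x, α x ^ 2) * ∑ y, η y ^ 2) := by
  have hY : (Fintype.card Y : ℝ) ≠ 0 := by exact_mod_cast Fintype.card_ne_zero
  have hx : ∀ x x' : X, x' ≠ x → ∑ f : X → Y, η (f x) * η (f x') = 0 := by
    intro x x' h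
    have := sum_sum_update (fun f : X → Y => η (f x) * η (f x')) x
    simp only [Function.update_self, Function.update_of_ne h, ← Finset.sum_mul, hη, zero_mul,
      Finset.sum_const_zero] at this
    exact (mul_eq_zero.1 this.symm).resolve_left hY
  have e : ∀ f : X → Y, (∑ x, α x * η (f x)) ^ 2 =
      ∑ x, ∑ x', α x * α x' * (η (f x) * η (f x')) := by
    intro f
    rw [sq, Finset.sum_mul_sum]
    exact Finset.sum_congr rfl fun x _ => Finset.sum_congr rfl fun x' _ => by ring
  simp_rw [e]
  rw [Finset.sum_comm]
  have e2 : ∀ x, ∑ f : X → Y, ∑ x', α x * α x' * (η (f x) * η (f x')) =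
      α x ^ 2 * ∑ f : X → Y, η (f x) ^ 2 := by
    intro x
    rw [Finset.sum_comm, Finset.sum_eq_single x]
    · rw [← Finset.mul_sum, sq]; simp_rw [sq]
    · intro x' _ h
      rw [← Finset.mul_sum, hx x x' h, mul_zero]
    · simp
  simp_rw [e2]
  rw [Finset.mul_sum, Finset.sum_mul, Finset.mul_sum]
  refine Finset.sum_congr rfl fun x _ => ?_
  have := sum_comp_eval (X := X) (fun y => η y ^ 2) x
  linear_combination α x ^ 2 * this

/-- For each observation `z`, the difference of the two laws has mean square at most `2^{-(ℓ-k)} q`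
with `q = 2^{-w}`. Cauchy-Schwarz bounds its mean absolute value by `q √(2^{-e})`, and there are `1
/ q` values of `z`. -/
lemma sum_colDist_le {ℓ e : ℕ} (W K : Finset (Fin ℓ)) (a : K → ZMod 2)
    (h : K.card + W.card + e ≤ ℓ) :
    ∑ f : (Fin ℓ → ZMod 2) → Fin ℓ → ZMod 2, colDist f W K a ≤
      Fintype.card ((Fin ℓ → ZMod 2) → Fin ℓ → ZMod 2) * √((1 / 2) ^ e) := by
  set F : ℝ := (Fintype.card ((Fin ℓ → ZMod 2) → Fin ℓ → ZMod 2) : ℝ) with hF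
  have hcX : (Fintype.card (Fin ℓ → ZMod 2) : ℝ) = 2 ^ ℓ := by simp [ZMod.card]
  set P : (Fin ℓ → ZMod 2) → ℝ := fun x => ∏ i, colBit K a i (x i) with hP
  set P' : (Fin ℓ → ZMod 2) → ℝ :=
    fun x => ∏ i, colBit (ℓ := ℓ) ∅ (fun _ => 0) i (x i) with hP'
  have P1 : ∑ x, P x = 1 := by
    rw [hP, sum_pi_prod, Finset.prod_eq_one fun i _ => sum_colBit K a i]
  have P'c : ∀ x, P' x = (1 / 2) ^ ℓ := fun x => by simp [hP', colBit]
  have P2 : ∑ x, P x ^ 2 = (1 / 2) ^ (ℓ - K.card) := by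
    have : ∀ x, P x ^ 2 = P x * (1 / 2) ^ (ℓ - K.card) := by
      intro x
      simp only [hP, prod_colBit]
      by_cases hx : (fun i : K => x i) = a
      · rw [ind_true hx]; ring
      · rw [ind_false hx]; ring
    simp_rw [this]
    rw [← Finset.sum_mul, P1, one_mul]
  have hα2 : ∑ x, (P x - P' x) ^ 2 ≤ (1 / 2) ^ (ℓ - K.card) := by
    simp_rw [P'c, sub_sq]
    rw [Finset.sum_add_distrib, Finset.sum_sub_distrib, P2, ← Finset.sum_mul, ← Finset.mul_sum, P1,
      Finset.sum_const, Finset.card_univ, nsmul_eq_mul, hcX]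
    have : (2 : ℝ) ^ ℓ * ((1 / 2) ^ ℓ) ^ 2 = (1 / 2) ^ ℓ := by
      rw [sq, ← mul_assoc, ← mul_pow]; norm_num
    rw [this]
    have : (0 : ℝ) < (1 / 2) ^ ℓ := by positivity
    linarith
  -- The signed weights have total mass zero, which permits subtracting the constant `q` from the
  -- indicator to obtain the centred `η`.
  have hα0 : ∑ x, (P x - P' x) = 0 := by
    rw [Finset.sum_sub_distrib, P1]
    simp_rw [P'c]
    rw [Finset.sum_const, Finset.card_univ, nsmul_eq_mul, hcX, ← mul_pow]
    norm_num
  set q : ℝ := (1 / 2) ^ W.card with hq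
  have hW : W.card ≤ ℓ := by omega
  have hqs : (2 : ℝ) ^ (ℓ - W.card) = 2 ^ ℓ * q := by
    rw [hq, one_div, inv_pow, pow_sub₀ _ two_ne_zero hW]
  have hz : ∀ z : W → ZMod 2,
      ∑ f : (Fin ℓ → ZMod 2) → Fin ℓ → ZMod 2,
        |colLaw f W K a z - colLaw f W ∅ (fun _ => 0) z| ≤ F * (q * √((1 / 2) ^ e)) := by
    intro z
    set η : (Fin ℓ → ZMod 2) → ℝ := fun y => ind ((fun i : W => y i) = z) - q with hη
    have η0 : ∑ y, η y = 0 := by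
      rw [hη, Finset.sum_sub_distrib, sum_ind_restrict, Finset.sum_const, Finset.card_univ,
        nsmul_eq_mul, hcX, hqs, sub_self]
    have η2 : ∑ y, η y ^ 2 ≤ 2 ^ ℓ * q := by
      have : ∀ y, η y ^ 2 = (1 - 2 * q) * ind ((fun i : W => y i) = z) + q ^ 2 := by
        intro y
        simp only [hη]
        by_cases hy : (fun i : W => y i) = z
        · rw [ind_true hy]; ring
        · rw [ind_false hy]; ring
      simp_rw [this]
      rw [Finset.sum_add_distrib, ← Finset.mul_sum, sum_ind_restrict, Finset.sum_const,
        Finset.card_univ, nsmul_eq_mul, hcX, hqs]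
      have : 0 ≤ (2 : ℝ) ^ ℓ * q ^ 2 := by positivity
      nlinarith
    have hD : ∀ f : (Fin ℓ → ZMod 2) → Fin ℓ → ZMod 2,
        colLaw f W K a z - colLaw f W ∅ (fun _ => 0) z = ∑ x, (P x - P' x) * η (f x) := by
      intro f
      simp only [hη, mul_sub]
      rw [Finset.sum_sub_distrib (f := fun x => (P x - P' x) * ind ((fun i : W => f x i) = z)),
        ← Finset.sum_mul, hα0, zero_mul, sub_zero, colLaw, colLaw, ← Finset.sum_sub_distrib]
      exact Finset.sum_congr rfl fun x _ => by rw [← sub_mul]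
    simp_rw [hD]
    have hsq := sum_sq_sum_mul_comp (X := Fin ℓ → ZMod 2) (fun x => P x - P' x) η η0
    rw [hcX] at hsq
    have hF0 : 0 ≤ F := Nat.cast_nonneg _
    have hS : ∑ f : (Fin ℓ → ZMod 2) → Fin ℓ → ZMod 2, (∑ x, (P x - P' x) * η (f x)) ^ 2 ≤
        F * ((1 / 2) ^ (ℓ - K.card) * q) := by
      refine le_of_mul_le_mul_left ?_ (show (0 : ℝ) < 2 ^ ℓ by positivity)
      rw [hsq]
      have : (∑ x, (P x - P' x) ^ 2) * ∑ y, η y ^ 2 ≤ (1 / 2) ^ (ℓ - K.card) * (2 ^ ℓ * q) :=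
        mul_le_mul hα2 η2 (Finset.sum_nonneg fun _ _ => sq_nonneg _) (by positivity)
      calc _ ≤ F * ((1 / 2) ^ (ℓ - K.card) * (2 ^ ℓ * q)) := mul_le_mul_of_nonneg_left this hF0
        _ = _ := by ring
    -- The rate condition enters here: `(ℓ - k) + w ≥ 2 w + e`.
    have hqe : (1 / 2 : ℝ) ^ (ℓ - K.card) * q ≤ q ^ 2 * (1 / 2) ^ e := by
      rw [hq, ← pow_mul, ← pow_add, ← pow_add]
      exact pow_le_pow_of_le_one (by norm_num) (by norm_num) (by omega)
    have hcs := sq_sum_le_card_mul_sum_sq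
      (s := (Finset.univ : Finset ((Fin ℓ → ZMod 2) → Fin ℓ → ZMod 2)))
      (f := fun f => |∑ x, (P x - P' x) * η (f x)|)
    simp only [sq_abs, Finset.card_univ] at hcs
    rw [← pow_le_pow_iff_left₀ (Finset.sum_nonneg fun _ _ => abs_nonneg _) (by positivity)
      two_ne_zero, mul_pow, mul_pow, Real.sq_sqrt (by positivity)]
    refine hcs.trans ?_
    rw [sq F, mul_assoc]
    exact mul_le_mul_of_nonneg_left (hS.trans (mul_le_mul_of_nonneg_left hqe hF0)) hF0
  unfold colDist
  rw [Finset.sum_comm]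
  refine (Finset.sum_le_sum fun z _ => hz z).trans (le_of_eq ?_)
  rw [Finset.sum_const, Finset.card_univ, nsmul_eq_mul]
  have : (Fintype.card (W → ZMod 2) : ℝ) * q = 1 := by
    simp only [Fintype.card_pi, ZMod.card, Finset.prod_const, Finset.card_univ, Fintype.card_coe]
    rw [hq]
    push_cast
    rw [← mul_pow]; norm_num
  linear_combination (F * √((1 / 2) ^ e)) * this

lemma meanLeakage_le {p : ℝ} (hp0 : 0 < p) (hp1 : p < 1) (β : ℝ) (m : ℕ) {ℓ ks d e : ℕ}
    (hd : (midSet p β m).card ≤ d) (W K : Finset (Fin ℓ)) (hK : K.card + W.card + e ≤ ℓ)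
    (v : K → Fin (2 ^ m) → ZMod 2) :
    meanLeakage p β m ks d W K v ≤ compLen p β m * √((1 / 2) ^ e) +
        2 * √(2 * (compLen p β m : ℝ) * (ℓ : ℝ) * delta β m) := by
  unfold meanLeakage
  set B := 2 * √(2 * (compLen p β m : ℝ) * (ℓ : ℝ) * delta β m)
  have hc : Fintype.card (Codebook ℓ ks) =
      Fintype.card ((Fin ℓ → ZMod 2) → Fin ℓ → ZMod 2) := Fintype.card_congr (codebookEquiv ℓ ks)
  have hpos : (0 : ℝ) < Fintype.card (Codebook ℓ ks) := by exact_mod_cast Fintype.card_pos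
  rw [div_le_iff₀ hpos]
  refine (Finset.sum_le_sum fun C _ => leakage_le hp0 hp1 β m hd C W K v).trans ?_
  rw [Finset.sum_add_distrib, Finset.sum_const, Finset.card_univ, nsmul_eq_mul, Finset.sum_comm,
    add_mul, mul_comm _ B]
  refine add_le_add ?_ le_rfl
  have h1 : ∀ j : highSet p β m, ∑ C : Codebook ℓ ks,
      colDist (chEncode C) W K (fun i => polarize m (v i) j.1) ≤
      Fintype.card (Codebook ℓ ks) * √((1 / 2) ^ e) := by
    intro j
    rw [hc]
    refine le_trans (le_of_eq ?_) (sum_colDist_le W K (fun i => polarize m (v i) j.1) hK)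
    exact (codebookEquiv ℓ ks).sum_comp
      (fun f => colDist f W K fun i => polarize m (v i) j.1)
  refine (Finset.sum_le_sum fun j _ => h1 j).trans ?_
  rw [Finset.sum_const, Finset.card_univ, nsmul_eq_mul, Fintype.card_coe, mul_right_comm,
    mul_assoc]
  refine mul_le_mul_of_nonneg_right ?_ (by positivity)
  exact_mod_cast Nat.le_add_right _ _

/-! ### Concentration for uniformly random permutations -/

open MeasureTheory ProbabilityTheory in
/-- Hoeffding's lemma for a Bernoulli variable. -/
lemma one_add_mul_exp_sub_one_le {q : ℝ} (h0 : 0 ≤ q) (h1 : q ≤ 1) (t : ℝ) :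
    1 + q * (Real.exp t - 1) ≤ Real.exp (q * t + t ^ 2 / 8) := by
  -- The Bernoulli law as a mixture of point masses; the subgaussian bound for variables in `[0, 1]`
  -- is applied to it and the mean `q` shifted back.
  let ν : Measure ℝ := ENNReal.ofReal q • Measure.dirac 1 + ENNReal.ofReal (1 - q) • Measure.dirac 0
  have hp : IsProbabilityMeasure ν := ⟨by
    simp only [ν, Measure.coe_add, Measure.coe_smul, Pi.add_apply, Pi.smul_apply, measure_univ,
      smul_eq_mul, mul_one]
    rw [← ENNReal.ofReal_add h0 (by linarith)]
    simp⟩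
  have hint : ∀ g : ℝ → ℝ, ∫ x, g x ∂ν = q * g 1 + (1 - q) * g 0 := by
    intro g
    rw [integral_add_measure, integral_smul_measure, integral_smul_measure, integral_dirac,
      integral_dirac, ENNReal.toReal_ofReal h0, ENNReal.toReal_ofReal (by linarith)]
    · rfl
    · exact (integrable_dirac (by simp)).smul_measure ENNReal.ofReal_ne_top
    · exact (integrable_dirac (by simp)).smul_measure ENNReal.ofReal_ne_top
  have hb : ∀ᵐ x ∂ν, (fun x : ℝ => x) x ∈ Set.Icc (0 : ℝ) 1 := by
    rw [ae_add_measure_iff]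
    exact ⟨Measure.ae_smul_measure (by simp [ae_dirac_eq]) _,
      Measure.ae_smul_measure (by simp [ae_dirac_eq]) _⟩
  have h := (hasSubgaussianMGF_of_mem_Icc (μ := ν) measurable_id.aemeasurable hb).mgf_le t
  rw [mgf, hint, hint] at h
  norm_num at h
  have h2 := mul_le_mul_of_nonneg_right h (Real.exp_pos (t * q)).le
  have e1 : Real.exp (t * (1 - q)) = Real.exp t * Real.exp (-(t * q)) := by
    rw [← Real.exp_add]; ring_nf
  rw [e1] at h2
  have e2 : Real.exp (-(t * q)) * Real.exp (t * q) = 1 := by rw [← Real.exp_add]; simp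
  calc 1 + q * (Real.exp t - 1)
      = (q * (Real.exp t * Real.exp (-(t * q))) + (1 - q) * Real.exp (-(t * q))) *
        Real.exp (t * q) := by linear_combination (-(q * Real.exp t) - (1 - q)) * e2
    _ ≤ _ := h2
    _ = _ := by rw [← Real.exp_add]; congr 1; ring

lemma ind_mem {X : Type*} (B : Finset X) (x : X) : ind (x ∈ B) = ∑ z ∈ B, ind (x = z) := by
  by_cases h : x ∈ B
  · rw [ind_true h, Finset.sum_eq_single_of_mem x h fun z _ hz => ind_false (Ne.symm hz),
      ind_true rfl]
  · rw [ind_false h, Finset.sum_eq_zero fun z hz => ind_false fun (e : x = z) => h (e ▸ hz)]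

lemma sum_ind_mem {X : Type*} [Fintype X] (B : Finset X) : ∑ x, ind (x ∈ B) = B.card := by
  rw [← Finset.sum_subset (Finset.subset_univ B) fun x _ hx => ind_false hx,
    Finset.sum_congr rfl fun x hx => ind_true hx]
  simp

section Perm

variable {X : Type*} [Fintype X] [DecidableEq X]

/-- Negative dependence: if `T` is mapped into `B`, a further point falls in `B` with conditional
probability `(|B| - |T|) / (|X| - |T|) ≤ |B| / |X|`. Composition with transpositions shows that all
points outside `T` play the same role. -/
lemma sum_perm_ind_insert_le (B T : Finset X) (s : X) (hs : s ∉ T) :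
    (Fintype.card X : ℝ) * ∑ σ : Equiv.Perm X, ∏ t ∈ insert s T, ind (σ t ∈ B) ≤
      B.card * ∑ σ : Equiv.Perm X, ∏ t ∈ T, ind (σ t ∈ B) := by
  set N := ∑ σ : Equiv.Perm X, ∏ t ∈ T, ind (σ t ∈ B) with hN
  set N' := ∑ σ : Equiv.Perm X, ∏ t ∈ insert s T, ind (σ t ∈ B) with hN'
  have N0 : 0 ≤ N := Finset.sum_nonneg fun _ _ => Finset.prod_nonneg fun _ _ => ind_nonneg _
  have hsym : ∀ s' ∈ Tᶜ, ∑ σ : Equiv.Perm X, ∏ t ∈ insert s' T, ind (σ t ∈ B) = N' := by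
    intro s' hs'
    rw [Finset.mem_compl] at hs'
    rw [hN', ← Equiv.sum_comp (Equiv.mulRight (Equiv.swap s s'))]
    refine Finset.sum_congr rfl fun σ _ => ?_
    rw [Finset.prod_insert hs', Finset.prod_insert hs]
    simp only [Equiv.coe_mulRight, Equiv.Perm.mul_apply, Equiv.swap_apply_right]
    congr 1
    refine Finset.prod_congr rfl fun t ht => ?_
    rw [Equiv.swap_apply_of_ne_of_ne]
    · rintro rfl; exact hs ht
    · rintro rfl; exact hs' ht
  have hmain : ((Tᶜ.card : ℕ) : ℝ) * N' = (B.card - T.card : ℝ) * N := by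
    rw [← nsmul_eq_mul, ← Finset.sum_const, ← Finset.sum_congr rfl hsym, Finset.sum_comm, hN,
      Finset.mul_sum]
    refine Finset.sum_congr rfl fun σ _ => ?_
    rw [Finset.sum_congr rfl fun s' hs' =>
      Finset.prod_insert (f := fun t => ind (σ t ∈ B)) (Finset.mem_compl.1 hs'), ← Finset.sum_mul]
    by_cases h : ∀ t ∈ T, σ t ∈ B
    · congr 1
      have h1 : ∑ x, ind (σ x ∈ B) = B.card := by
        rw [Equiv.sum_comp σ (fun y => ind (y ∈ B)), sum_ind_mem]
      have h2 : ∑ x ∈ T, ind (σ x ∈ B) = T.card := by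
        rw [Finset.sum_congr rfl fun t ht => ind_true (h t ht)]
        simp
      rw [← Finset.sum_add_sum_compl T, h2] at h1
      linarith
    · push Not at h
      obtain ⟨t, ht, htB⟩ := h
      rw [Finset.prod_eq_zero ht (ind_false htB), mul_zero, mul_zero]
  rw [Finset.card_compl, Nat.cast_sub (Finset.card_le_univ T)] at hmain
  have hlt : (T.card : ℝ) < Fintype.card X := by
    exact_mod_cast Finset.card_lt_univ_of_notMem hs
  have hB : (B.card : ℝ) ≤ Fintype.card X := by exact_mod_cast Finset.card_le_univ B
  have hT : (0 : ℝ) ≤ T.card := Nat.cast_nonneg _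
  refine le_of_mul_le_mul_left ?_ (sub_pos.2 hlt)
  calc _ = Fintype.card X * ((B.card - T.card : ℝ) * N) := by rw [← hmain]; ring
    _ ≤ _ := by
      have : 0 ≤ (T.card : ℝ) * (Fintype.card X - B.card) * N :=
        mul_nonneg (mul_nonneg hT (by linarith)) N0
      nlinarith

lemma sum_perm_ind_le [Nonempty X] (B T : Finset X) :
    ∑ σ : Equiv.Perm X, ∏ t ∈ T, ind (σ t ∈ B) ≤
      Fintype.card (Equiv.Perm X) * ((B.card : ℝ) / Fintype.card X) ^ T.card := by
  have hX : (0 : ℝ) < Fintype.card X := by exact_mod_cast Fintype.card_pos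
  induction T using Finset.induction_on with
  | empty => simp
  | insert s T hs ih =>
    have h := sum_perm_ind_insert_le B T s hs
    rw [Finset.card_insert_of_notMem hs, pow_succ]
    rw [mul_comm, ← le_div_iff₀ hX] at h
    refine h.trans ?_
    rw [div_le_iff₀ hX]
    calc _ ≤ (B.card : ℝ) * (Fintype.card (Equiv.Perm X) *
          ((B.card : ℝ) / Fintype.card X) ^ T.card) :=
          mul_le_mul_of_nonneg_left ih (Nat.cast_nonneg _)
      _ = _ := by field_simp

/-- The product is expanded over subsets of `S`. As `y ≥ 0`, each monomial is at most its value for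
independent sampling, so the moment generating function is dominated by the binomial one. -/
lemma sum_perm_prod_one_add_le [Nonempty X] (B S : Finset X) {y : ℝ} (hy : 0 ≤ y) :
    ∑ σ : Equiv.Perm X, ∏ s ∈ S, (1 + y * ind (σ s ∈ B)) ≤
      Fintype.card (Equiv.Perm X) * (1 + (B.card : ℝ) / Fintype.card X * y) ^ S.card := by
  simp_rw [Finset.prod_one_add]
  rw [Finset.sum_comm]
  have : (1 + (B.card : ℝ) / Fintype.card X * y) ^ S.card =
      ∑ T ∈ S.powerset, y ^ T.card * ((B.card : ℝ) / Fintype.card X) ^ T.card := by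
    rw [← Finset.prod_const, Finset.prod_one_add]
    refine Finset.sum_congr rfl fun T _ => ?_
    rw [Finset.prod_const, mul_pow, mul_comm]
  rw [this, Finset.mul_sum]
  refine Finset.sum_le_sum fun T _ => ?_
  simp_rw [Finset.prod_mul_distrib, Finset.prod_const]
  rw [← Finset.mul_sum, mul_left_comm]
  exact mul_le_mul_of_nonneg_left (sum_perm_ind_le B T) (by positivity)

/-- Hoeffding's inequality for sampling without replacement. -/
lemma sum_perm_ind_card_ge_le [Nonempty X] (B S : Finset X) {ε : ℝ} (hε : 0 ≤ ε) :
    ∑ σ : Equiv.Perm X,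
        ind (S.card * ((B.card : ℝ) / Fintype.card X + ε) ≤ ∑ s ∈ S, ind (σ s ∈ B)) ≤
      Fintype.card (Equiv.Perm X) * Real.exp (-(2 * S.card * ε ^ 2)) := by
  have hX : (0 : ℝ) < Fintype.card X := by exact_mod_cast Fintype.card_pos
  set q : ℝ := (B.card : ℝ) / Fintype.card X with hq
  have hq0 : 0 ≤ q := by positivity
  have hq1 : q ≤ 1 := (div_le_one hX).2 (by exact_mod_cast Finset.card_le_univ B)
  -- The minimizer of the Chernoff exponent `- t ε + t ^ 2 / 8`, with value `- 2 ε ^ 2`.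
  set t : ℝ := 4 * ε with ht
  have hy : 0 ≤ Real.exp t - 1 := by
    have := Real.add_one_le_exp t
    have : 0 ≤ t := by positivity
    linarith
  have h1 : ∀ σ : Equiv.Perm X, ind (S.card * (q + ε) ≤ ∑ s ∈ S, ind (σ s ∈ B)) ≤
      Real.exp (-(t * (S.card * (q + ε)))) *
        ∏ s ∈ S, (1 + (Real.exp t - 1) * ind (σ s ∈ B)) := by
    intro σ
    have e : ∏ s ∈ S, (1 + (Real.exp t - 1) * ind (σ s ∈ B)) =
        Real.exp (t * ∑ s ∈ S, ind (σ s ∈ B)) := by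
      rw [Finset.mul_sum, Real.exp_sum]
      refine Finset.prod_congr rfl fun s _ => ?_
      by_cases h : σ s ∈ B
      · rw [ind_true h]; simp
      · rw [ind_false h]; simp
    rw [e, ← Real.exp_add]
    by_cases h : S.card * (q + ε) ≤ ∑ s ∈ S, ind (σ s ∈ B)
    · rw [ind_true h]
      refine Real.one_le_exp ?_
      have := mul_le_mul_of_nonneg_left h (show 0 ≤ t by positivity)
      linarith
    · rw [ind_false h]
      exact (Real.exp_pos _).le
  refine (Finset.sum_le_sum fun σ _ => h1 σ).trans ?_
  rw [← Finset.mul_sum]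
  have h2 := sum_perm_prod_one_add_le B S hy
  have h3 : (1 + q * (Real.exp t - 1)) ^ S.card ≤ Real.exp (S.card * (q * t + t ^ 2 / 8)) := by
    rw [Real.exp_nat_mul]
    exact pow_le_pow_left₀ (by positivity) (one_add_mul_exp_sub_one_le hq0 hq1 t) _
  calc _ ≤ Real.exp (-(t * (S.card * (q + ε)))) * (Fintype.card (Equiv.Perm X) *
        Real.exp (S.card * (q * t + t ^ 2 / 8))) :=
        mul_le_mul_of_nonneg_left (h2.trans (mul_le_mul_of_nonneg_left h3 (Nat.cast_nonneg _)))
          (Real.exp_pos _).le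
    _ = _ := by
      rw [mul_left_comm, ← Real.exp_add]
      congr 2
      rw [ht]; ring

end Perm

lemma sum_abs_sub_eq_two_mul {Z : Type*} [Fintype Z] (f g : Z → ℝ)
    (h : ∑ z, f z = ∑ z, g z) :
    ∑ z, |f z - g z| = 2 * ∑ z ∈ Finset.univ.filter (fun z => g z < f z), (f z - g z) := by
  have h0 : ∑ z, (f z - g z) = 0 := by rw [Finset.sum_sub_distrib, h, sub_self]
  rw [Finset.sum_filter]
  calc _ = ∑ z, (2 * (if g z < f z then f z - g z else 0) - (f z - g z)) := by
        refine Finset.sum_congr rfl fun z _ => ?_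
        split_ifs with hz
        · rw [abs_of_pos (by linarith)]; ring
        · rw [abs_of_nonpos (by linarith)]; ring
    _ = _ := by rw [Finset.sum_sub_distrib, h0, sub_zero, Finset.mul_sum]

/-! ### Bijective codes with small leakage -/

section Code

variable {ℓ : ℕ} (W K : Finset (Fin ℓ)) (a : K → ZMod 2)

lemma card_columns (ℓ : ℕ) : (Fintype.card (Fin ℓ → ZMod 2) : ℝ) = 2 ^ ℓ := by simp [ZMod.card]

lemma card_eq_sum_ind {X : Type*} [Fintype X] (P : X → Prop) [DecidablePred P] :
    ((Finset.univ.filter P).card : ℝ) = ∑ x, ind (P x) := by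
  rw [Finset.card_filter]
  push_cast
  refine Finset.sum_congr rfl fun x _ => ?_
  by_cases h : P x <;> simp [ind, h]

lemma two_pow_mul_half_pow (n : ℕ) : (2 : ℝ) ^ n * (1 / 2) ^ n = 1 := by
  rw [← mul_pow]; norm_num

lemma colLaw_eq (f : (Fin ℓ → ZMod 2) → Fin ℓ → ZMod 2) (z : W → ZMod 2) :
    colLaw f W K a z = (1 / 2) ^ (ℓ - K.card) *
      ∑ x : Fin ℓ → ZMod 2, ind ((fun i : K => x i) = a) * ind ((fun i : W => f x i) = z) := by
  unfold colLaw
  simp_rw [prod_colBit]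
  rw [Finset.mul_sum]
  exact Finset.sum_congr rfl fun x _ => by ring

lemma colLaw_empty_of_bijective {f : (Fin ℓ → ZMod 2) → Fin ℓ → ZMod 2}
    (hf : Function.Bijective f) (z : W → ZMod 2) :
    colLaw f W ∅ (fun _ => 0) z = (1 / 2) ^ W.card := by
  have hW : W.card ≤ ℓ := by simpa using Finset.card_le_univ W
  have h : ∀ x : Fin ℓ → ZMod 2,
      ind ((fun i : (∅ : Finset (Fin ℓ)) => x i) = fun _ => 0) = 1 :=
    fun x => ind_true (Subsingleton.elim _ _)
  rw [colLaw_eq]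
  simp_rw [h, one_mul]
  rw [hf.sum_comp (fun y : Fin ℓ → ZMod 2 => ind ((fun i : W => y i) = z)), sum_ind_restrict,
    Finset.card_empty, Nat.sub_zero]
  have h1 : (1 / 2 : ℝ) ^ ℓ = (1 / 2) ^ (ℓ - W.card) * (1 / 2) ^ W.card := by
    rw [← pow_add, Nat.sub_add_cancel hW]
  rw [h1, mul_right_comm, mul_comm ((1 / 2 : ℝ) ^ _), two_pow_mul_half_pow, one_mul]

/-- The distance is twice the largest excess over events `B`, of which there are `2 ^ 2 ^ w`. For a
permutation the unconditional law is uniform, so a large distance means that the `2 ^ (ℓ - k)`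
columns compatible with `a` hit the preimage of some `B` too often. Hoeffding's inequality applies
with excess `s / 2`. -/
lemma sum_perm_ind_colDist_le {s : ℝ} (hs : 0 ≤ s) :
    ∑ σ : Equiv.Perm (Fin ℓ → ZMod 2), ind (s < colDist σ W K a) ≤
      2 ^ 2 ^ W.card * (Fintype.card (Equiv.Perm (Fin ℓ → ZMod 2)) *
        Real.exp (-(2 ^ (ℓ - K.card) * s ^ 2 / 2))) := by
  classical
  have hW : W.card ≤ ℓ := by simpa using Finset.card_le_univ W
  set S : Finset (Fin ℓ → ZMod 2) := Finset.univ.filter fun x => (fun i : K => x i) = a with hS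
  set pre : Finset (W → ZMod 2) → Finset (Fin ℓ → ZMod 2) := fun B =>
    Finset.univ.filter fun y => (fun i : W => y i) ∈ B with hpre
  have cS : (S.card : ℝ) = 2 ^ (ℓ - K.card) := by
    rw [hS, card_eq_sum_ind, sum_ind_restrict]
  have hind : ∀ (B : Finset (W → ZMod 2)) (y : Fin ℓ → ZMod 2),
      ind (y ∈ pre B) = ∑ z ∈ B, ind ((fun i : W => y i) = z) := by
    intro B y
    rw [← ind_mem]
    simp [hpre]
  have cpre : ∀ B, ((pre B).card : ℝ) / Fintype.card (Fin ℓ → ZMod 2) =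
      B.card * (1 / 2) ^ W.card := by
    intro B
    have h1 : ((pre B).card : ℝ) = B.card * 2 ^ (ℓ - W.card) := by
      calc ((pre B).card : ℝ) = ∑ y, ind (y ∈ pre B) := (sum_ind_mem _).symm
        _ = _ := by
          simp_rw [hind]
          rw [Finset.sum_comm]
          simp_rw [sum_ind_restrict]
          simp
    rw [h1, card_columns, pow_sub₀ _ two_ne_zero hW, one_div, inv_pow]
    field_simp
  have h1 : ∀ σ : Equiv.Perm (Fin ℓ → ZMod 2), ind (s < colDist σ W K a) ≤
      ∑ B : Finset (W → ZMod 2),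
        ind (S.card * (((pre B).card : ℝ) / Fintype.card (Fin ℓ → ZMod 2) + s / 2) ≤
          ∑ x ∈ S, ind (σ x ∈ pre B)) := by
    intro σ
    refine (ind_mono fun h => ?_).trans (ind_exists_le Finset.univ _)
    unfold colDist at h
    rw [sum_abs_sub_eq_two_mul _ _ ((sum_colLaw _ _ _ _).trans (sum_colLaw _ _ _ _).symm)] at h
    set B := Finset.univ.filter fun z =>
      colLaw σ W ∅ (fun _ => 0) z < colLaw σ W K a z
    refine ⟨B, Finset.mem_univ _, ?_⟩
    rw [Finset.sum_sub_distrib,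
      Finset.sum_congr rfl fun z _ => colLaw_empty_of_bijective W σ.bijective z, Finset.sum_const,
      nsmul_eq_mul, ← cpre,
      Finset.sum_congr rfl fun z _ => colLaw_eq W K a σ z, ← Finset.mul_sum] at h
    have h2 : ∑ z ∈ B, ∑ x : Fin ℓ → ZMod 2,
        ind ((fun i : K => x i) = a) * ind ((fun i : W => σ x i) = z) =
        ∑ x ∈ S, ind (σ x ∈ pre B) := by
      rw [Finset.sum_comm, hS, Finset.sum_filter]
      refine Finset.sum_congr rfl fun x _ => ?_
      rw [← Finset.mul_sum, ← hind]
      by_cases hx : (fun i : K => x i) = a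
      · rw [ind_true hx, if_pos hx, one_mul]
      · rw [ind_false hx, if_neg hx, zero_mul]
    rw [h2] at h
    have h3 := two_pow_mul_half_pow (ℓ - K.card)
    rw [← cS] at h3
    have h4 : (0 : ℝ) ≤ S.card := Nat.cast_nonneg _
    have h5 : ((pre B).card : ℝ) / Fintype.card (Fin ℓ → ZMod 2) + s / 2 ≤
      (1 / 2) ^ (ℓ - K.card) * ∑ x ∈ S, ind (σ x ∈ pre B) := by linarith
    refine (mul_le_mul_of_nonneg_left h5 h4).trans (le_of_eq ?_)
    rw [← mul_assoc, h3, one_mul]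
  refine (Finset.sum_le_sum fun σ _ => h1 σ).trans ?_
  rw [Finset.sum_comm]
  refine (Finset.sum_le_sum fun B _ =>
    sum_perm_ind_card_ge_le (pre B) S (ε := s / 2) (by positivity)).trans (le_of_eq ?_)
  rw [Finset.sum_const, Finset.card_univ, nsmul_eq_mul, cS, Fintype.card_finset]
  have : Fintype.card (W → ZMod 2) = 2 ^ W.card := by simp [ZMod.card]
  rw [this]
  push_cast
  congr 4
  ring

end Code

/-- Union bound over `W`, `K` and the `2 ^ k` known column values; fewer than all permutations are
bad. -/
lemma exists_perm_colDist_le {ℓ w k : ℕ} {s : ℝ} (hs : 0 ≤ s)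
    (h : (ℓ.choose w : ℝ) * (ℓ.choose k * 2 ^ k) *
      (2 ^ 2 ^ w * Real.exp (-(2 ^ (ℓ - k) * s ^ 2 / 2))) < 1) :
    ∃ σ : Equiv.Perm (Fin ℓ → ZMod 2), ∀ W K : Finset (Fin ℓ), W.card = w → K.card = k →
      ∀ a : K → ZMod 2, colDist σ W K a ≤ s := by
  classical
  by_contra hc
  push Not at hc
  have hbad : ∀ σ : Equiv.Perm (Fin ℓ → ZMod 2), (1 : ℝ) ≤
      ∑ W ∈ Finset.powersetCard w (Finset.univ : Finset (Fin ℓ)),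
        ∑ K ∈ Finset.powersetCard k (Finset.univ : Finset (Fin ℓ)), ∑ a : K → ZMod 2,
          ind (s < colDist σ W K a) := by
    intro σ
    obtain ⟨W, K, hW, hK, a, ha⟩ := hc σ
    have n1 : ∀ W K : Finset (Fin ℓ), 0 ≤ ∑ a : K → ZMod 2, ind (s < colDist σ W K a) :=
      fun W K => Finset.sum_nonneg fun _ _ => ind_nonneg _
    calc (1 : ℝ) = ind (s < colDist σ W K a) := (ind_true ha).symm
      _ ≤ ∑ a : K → ZMod 2, ind (s < colDist σ W K a) :=
        Finset.single_le_sum (f := fun a => ind (s < colDist σ W K a))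
          (fun _ _ => ind_nonneg _) (Finset.mem_univ a)
      _ ≤ ∑ K ∈ Finset.powersetCard k (Finset.univ : Finset (Fin ℓ)), ∑ a : K → ZMod 2,
          ind (s < colDist σ W K a) :=
        Finset.single_le_sum (f := fun K : Finset (Fin ℓ) =>
          ∑ a : K → ZMod 2, ind (s < colDist σ W K a)) (fun _ _ => n1 _ _)
          (Finset.mem_powersetCard.2 ⟨Finset.subset_univ _, hK⟩)
      _ ≤ _ := Finset.single_le_sum (f := fun W : Finset (Fin ℓ) =>
          ∑ K ∈ Finset.powersetCard k (Finset.univ : Finset (Fin ℓ)), ∑ a : K → ZMod 2,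
          ind (s < colDist σ W K a)) (fun _ _ => Finset.sum_nonneg fun _ _ => n1 _ _)
          (Finset.mem_powersetCard.2 ⟨Finset.subset_univ _, hW⟩)
  set M : ℝ := (Fintype.card (Equiv.Perm (Fin ℓ → ZMod 2)) : ℝ) with hM
  have hM0 : 0 < M := Nat.cast_pos.2 Fintype.card_pos
  set D : ℝ := 2 ^ 2 ^ w * (M * Real.exp (-(2 ^ (ℓ - k) * s ^ 2 / 2))) with hD
  have h1 : M ≤ ∑ W ∈ Finset.powersetCard w (Finset.univ : Finset (Fin ℓ)),
        ∑ K ∈ Finset.powersetCard k (Finset.univ : Finset (Fin ℓ)), ∑ a : K → ZMod 2, D := by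
    calc M = ∑ σ : Equiv.Perm (Fin ℓ → ZMod 2), (1 : ℝ) := by simp [hM]
      _ ≤ _ := Finset.sum_le_sum fun σ _ => hbad σ
      _ = ∑ W ∈ Finset.powersetCard w (Finset.univ : Finset (Fin ℓ)),
          ∑ K ∈ Finset.powersetCard k (Finset.univ : Finset (Fin ℓ)), ∑ a : K → ZMod 2,
            ∑ σ : Equiv.Perm (Fin ℓ → ZMod 2), ind (s < colDist σ W K a) := by
        rw [Finset.sum_comm]
        refine Finset.sum_congr rfl fun W _ => ?_
        rw [Finset.sum_comm]
        exact Finset.sum_congr rfl fun K _ => Finset.sum_comm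
      _ ≤ _ := by
        refine Finset.sum_le_sum fun W hW => Finset.sum_le_sum fun K hK =>
          Finset.sum_le_sum fun a _ => ?_
        have h := sum_perm_ind_colDist_le W K a hs
        rwa [(Finset.mem_powersetCard.1 hW).2, (Finset.mem_powersetCard.1 hK).2] at h
  have h2 : ∑ W ∈ Finset.powersetCard w (Finset.univ : Finset (Fin ℓ)),
        ∑ K ∈ Finset.powersetCard k (Finset.univ : Finset (Fin ℓ)), ∑ a : K → ZMod 2, D =
      (ℓ.choose w : ℝ) * (ℓ.choose k * 2 ^ k) * D := by
    have : ∀ K ∈ Finset.powersetCard k (Finset.univ : Finset (Fin ℓ)),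
        ∑ a : K → ZMod 2, D = 2 ^ k * D := by
      intro K hK
      rw [Finset.sum_const, Finset.card_univ, nsmul_eq_mul]
      congr 1
      simp [ZMod.card, (Finset.mem_powersetCard.1 hK).2]
    rw [Finset.sum_congr rfl fun W _ => Finset.sum_congr rfl this]
    simp only [Finset.sum_const, Finset.card_powersetCard, Finset.card_univ, Fintype.card_fin,
      nsmul_eq_mul]
    ring
  rw [h2, hD] at h1
  have h3 := mul_lt_mul_of_pos_right h hM0
  rw [one_mul] at h3
  refine absurd h1 (not_le.2 (lt_of_eq_of_lt ?_ h3))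
  ring

/-! ### Perfect secrecy when at most one link is observed -/

lemma colDist_eq_zero_of_card_eq_zero {ℓ : ℕ} (f : (Fin ℓ → ZMod 2) → Fin ℓ → ZMod 2)
    (W K : Finset (Fin ℓ)) (a : K → ZMod 2) (hW : W.card = 0) : colDist f W K a = 0 := by
  obtain rfl := Finset.card_eq_zero.1 hW
  have h : ∀ (K' : Finset (Fin ℓ)) (a' : K' → ZMod 2) z, colLaw f ∅ K' a' z = 1 := by
    intro K' a' z
    rw [← sum_colLaw f ∅ K' a', Fintype.sum_subsingleton _ z]
  exact Finset.sum_eq_zero fun z _ => by rw [h, h, sub_self, abs_zero]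

/-- A linear code on columns in which every codeword bit involves at least `ℓ - 1` column bits. -/
def parityCode (ℓ : ℕ) (x : Fin ℓ → ZMod 2) (i : Fin ℓ) : ZMod 2 :=
  if (i : ℕ) = 0 then ∑ k, x k else ∑ k, x k - x i

lemma parityCode_bijective (ℓ : ℕ) : Function.Bijective (parityCode ℓ) := by
  refine Finite.injective_iff_bijective.1 fun x y hxy => ?_
  rcases Nat.eq_zero_or_pos ℓ with rfl | hℓ
  · exact Subsingleton.elim _ _
  have hs : ∑ k, x k = ∑ k, y k := by simpa [parityCode] using congrFun hxy ⟨0, hℓ⟩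
  have hne : ∀ i : Fin ℓ, (i : ℕ) ≠ 0 → x i = y i := by
    intro i hi
    have := congrFun hxy i
    simp only [parityCode, hi, if_false, hs] at this
    exact sub_right_injective this
  funext i
  by_cases hi : (i : ℕ) = 0
  · have h1 : ∑ k ∈ Finset.univ.erase i, x k = ∑ k ∈ Finset.univ.erase i, y k := by
      refine Finset.sum_congr rfl fun k hk => hne k fun h0 => ?_
      exact Finset.ne_of_mem_erase hk (Fin.ext (h0.trans hi.symm))
    rw [← Finset.add_sum_erase _ x (Finset.mem_univ i),
      ← Finset.add_sum_erase _ y (Finset.mem_univ i), h1] at hs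
    exact add_right_cancel hs
  · exact hne i hi

lemma parityCode_add_single {ℓ : ℕ} (x : Fin ℓ → ZMod 2) {i k : Fin ℓ} (hk : k ≠ i) :
    parityCode ℓ (x + Pi.single k 1) i = parityCode ℓ x i + 1 := by
  have h : ∑ j, (x + Pi.single k 1 : Fin ℓ → ZMod 2) j = ∑ j, x j + 1 := by
    simp [Finset.sum_add_distrib]
  unfold parityCode
  rw [h]
  split_ifs
  · rfl
  · simp only [Pi.add_apply, Pi.single_eq_of_ne hk.symm, add_zero]
    ring

/-- Since `K.card + 2 ≤ ℓ`, some column bit `k ≠ i` is unknown. Flipping it preserves the law of the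
column and flips the observed codeword bit, which is therefore fair. -/
lemma colLaw_parityCode {ℓ : ℕ} (i : Fin ℓ) (K : Finset (Fin ℓ)) (a : K → ZMod 2)
    (hK : K.card + 2 ≤ ℓ) (z : ({i} : Finset (Fin ℓ)) → ZMod 2) :
    colLaw (parityCode ℓ) {i} K a z = 1 / 2 := by
  obtain ⟨k, hk⟩ : ∃ k, k ∉ insert i K := by
    by_contra h
    push Not at h
    have h1 : (insert i K).card = ℓ := by
      rw [Finset.eq_univ_of_forall h, Finset.card_univ, Fintype.card_fin]
    have := Finset.card_insert_le i K
    omega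
  rw [Finset.mem_insert, not_or] at hk
  set b := z ⟨i, Finset.mem_singleton_self i⟩
  have hz : ∀ y : Fin ℓ → ZMod 2, ind ((fun j : ({i} : Finset (Fin ℓ)) => y j) = z) =
      ind (y i = b) := by
    intro y
    congr 1
    refine propext ⟨fun h => congrFun h ⟨i, Finset.mem_singleton_self i⟩, fun h => ?_⟩
    funext ⟨j, hj⟩
    obtain rfl := Finset.mem_singleton.1 hj
    exact h
  set P : (Fin ℓ → ZMod 2) → ℝ := fun x => ∏ j, colBit K a j (x j) with hP
  have hPk : ∀ x, P (x + Pi.single k 1) = P x := by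
    intro x
    refine Finset.prod_congr rfl fun j _ => ?_
    by_cases hj : j = k
    · subst hj
      simp [colBit, hk.2]
    · simp [hj]
  have P1 : ∑ x, P x = 1 := by
    rw [hP, sum_pi_prod, Finset.prod_eq_one fun j _ => sum_colBit K a j]
  have e1 : colLaw (parityCode ℓ) {i} K a z = ∑ x, P x * ind (parityCode ℓ x i = b) :=
    Finset.sum_congr rfl fun x _ => by rw [hz]
  have e2 : ∑ x, P x * ind (parityCode ℓ x i = b) = ∑ x, P x * ind (parityCode ℓ x i + 1 = b) := by
    rw [← Equiv.sum_comp (Equiv.addRight (Pi.single k 1 : Fin ℓ → ZMod 2))]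
    refine Finset.sum_congr rfl fun x _ => ?_
    rw [Equiv.coe_addRight, hPk, parityCode_add_single x hk.1]
  have e3 : ∀ x, P x * ind (parityCode ℓ x i = b) + P x * ind (parityCode ℓ x i + 1 = b) =
      P x := by
    intro x
    have h2 : ∀ c b : ZMod 2, (c = b ∧ c + 1 ≠ b) ∨ (c ≠ b ∧ c + 1 = b) := by decide
    rcases h2 (parityCode ℓ x i) b with h | h
    · rw [ind_true h.1, ind_false h.2]; ring
    · rw [ind_false h.1, ind_true h.2]; ring
  have e4 := Finset.sum_congr (rfl : (Finset.univ : Finset (Fin ℓ → ZMod 2)) = Finset.univ)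
    fun x _ => e3 x
  rw [Finset.sum_add_distrib, P1] at e4
  rw [e1]
  linarith

lemma colDist_parityCode {ℓ : ℕ} (W K : Finset (Fin ℓ)) (a : K → ZMod 2) (hW : W.card = 1)
    (hK : K.card + 2 ≤ ℓ) : colDist (parityCode ℓ) W K a = 0 := by
  obtain ⟨i, rfl⟩ := Finset.card_eq_one.1 hW
  refine Finset.sum_eq_zero fun z _ => ?_
  rw [colLaw_parityCode i K a hK, colLaw_parityCode i ∅ _ (by simp; omega), sub_self, abs_zero]

/-! ### Numerical estimates and choice of the column code -/

lemma rpow_le_two_pow {ℓ e : ℕ} (hℓ : 0 < ℓ) {s : ℝ} (h : s * Real.logb 2 ℓ ≤ e) :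
    (ℓ : ℝ) ^ s ≤ 2 ^ e := by
  have hℓ' : (0 : ℝ) < ℓ := by exact_mod_cast hℓ
  rw [← Real.rpow_natCast]
  calc (ℓ : ℝ) ^ s = ((2 : ℝ) ^ Real.logb 2 ℓ) ^ s := by
        rw [Real.rpow_logb two_pos (by norm_num) hℓ']
    _ = (2 : ℝ) ^ (s * Real.logb 2 ℓ) := by rw [← Real.rpow_mul two_pos.le, mul_comm]
    _ ≤ _ := Real.rpow_le_rpow_of_exponent_le one_le_two h

lemma sqrt_half_pow_le {ℓ e : ℕ} (hℓ : 0 < ℓ) {t : ℝ} (h : t * Real.logb 2 ℓ ≤ e) :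
    √((1 / 2) ^ e) ≤ (ℓ : ℝ) ^ (-(t / 2)) := by
  have hℓ' : (0 : ℝ) < ℓ := by exact_mod_cast hℓ
  have h1 := rpow_le_two_pow hℓ h
  refine Real.sqrt_le_iff.2 ⟨(Real.rpow_pos_of_pos hℓ' _).le, ?_⟩
  rw [← Real.rpow_natCast ((ℓ : ℝ) ^ (-(t / 2))) 2, ← Real.rpow_mul hℓ'.le]
  have e1 : -(t / 2) * (2 : ℕ) = -t := by push_cast; ring
  rw [e1, Real.rpow_neg hℓ'.le, one_div, inv_pow]
  exact inv_anti₀ (Real.rpow_pos_of_pos hℓ' _) h1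

lemma choose_mul_two_pow_le (ℓ k : ℕ) : (ℓ.choose k : ℝ) * 2 ^ k ≤ 3 ^ ℓ := by
  rcases lt_or_ge ℓ k with h | h
  · rw [Nat.choose_eq_zero_of_lt h]; simp
  · have h1 : (3 : ℝ) ^ ℓ = ∑ j ∈ Finset.range (ℓ + 1), 2 ^ j * (ℓ.choose j : ℝ) := by
      rw [show (3 : ℝ) = 2 + 1 by norm_num, add_pow]; simp
    rw [h1, mul_comm]
    exact Finset.single_le_sum (f := fun j => (2 : ℝ) ^ j * (ℓ.choose j : ℝ))
      (fun j _ => by positivity) (Finset.mem_range.2 (by omega))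

/-- The choices of `W`, `K` and column values number at most `6 ^ ℓ`. With `log 6 ≤ 9/5` and `log 2
≤ 7/10` the total exponent is at most `9 ℓ / 5 + 2 ^ w (7/10 - ℓ / 2)`, which is negative once `2 ^
w ≥ 4` and `ℓ ≥ 15`. -/
lemma union_bound_lt_one {ℓ w k : ℕ} (hℓ : 15 ≤ ℓ) (hw : 2 ≤ w) {y : ℝ}
    (hy : 2 ^ w * (ℓ : ℝ) ≤ y) :
    (ℓ.choose w : ℝ) * (ℓ.choose k * 2 ^ k) * (2 ^ 2 ^ w * Real.exp (-(y / 2))) < 1 := by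
  have h1 : (ℓ.choose w : ℝ) ≤ 2 ^ ℓ := by exact_mod_cast Nat.choose_le_two_pow ℓ w
  have h2 := choose_mul_two_pow_le ℓ k
  have h6 : (6 : ℝ) ≤ Real.exp (9 / 5) := by
    refine le_of_pow_le_pow_left₀ (n := 5) (by norm_num) (Real.exp_pos _).le ?_
    rw [← Real.exp_nat_mul]
    have : ((5 : ℕ) : ℝ) * (9 / 5) = ((9 : ℕ) : ℝ) * 1 := by norm_num
    rw [this, Real.exp_nat_mul]
    calc (6 : ℝ) ^ 5 ≤ 2.718 ^ 9 := by norm_num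
      _ ≤ _ := pow_le_pow_left₀ (by norm_num) (by linarith [Real.exp_one_gt_d9]) _
  have h7 : (2 : ℝ) ≤ Real.exp (7 / 10) := by
    rw [← Real.log_le_iff_le_exp two_pos]
    linarith [Real.log_two_lt_d9]
  have h8 : (2 : ℝ) ^ 2 ^ w ≤ Real.exp (2 ^ w * (7 / 10)) := by
    have := pow_le_pow_left₀ two_pos.le h7 (2 ^ w)
    rw [← Real.exp_nat_mul] at this
    push_cast at this
    exact this
  have h9 : (ℓ.choose w : ℝ) * (ℓ.choose k * 2 ^ k) ≤ Real.exp (ℓ * (9 / 5)) := by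
    calc _ ≤ (2 : ℝ) ^ ℓ * 3 ^ ℓ := mul_le_mul h1 h2 (by positivity) (by positivity)
      _ = 6 ^ ℓ := by rw [← mul_pow]; norm_num
      _ ≤ _ := by
        rw [Real.exp_nat_mul]
        exact pow_le_pow_left₀ (by norm_num) h6 _
  have hx : (4 : ℝ) ≤ 2 ^ w := by
    calc (4 : ℝ) = 2 ^ 2 := by norm_num
      _ ≤ 2 ^ w := pow_le_pow_right₀ one_le_two hw
  have hℓ' : (15 : ℝ) ≤ ℓ := by exact_mod_cast hℓ
  calc _ ≤ Real.exp (ℓ * (9 / 5)) * (Real.exp (2 ^ w * (7 / 10)) * Real.exp (-(y / 2))) :=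
        mul_le_mul h9 (mul_le_mul_of_nonneg_right h8 (Real.exp_pos _).le) (by positivity)
          (Real.exp_pos _).le
    _ < 1 := by
      rw [← Real.exp_add, ← Real.exp_add, Real.exp_lt_one_iff]
      nlinarith

/-- For `w ≥ 2` the Hoeffding exponent involves `2 ^ (ℓ - k) ℓ ^ (-t) ≥ 2 ^ w 2 ^ e ℓ ^ (-t) ≥ 2 ^ w
ℓ`. The extra factor `ℓ`, from `t + 1` in place of `t`, pays for the union bound. Smaller `w` are
handled by explicit codes. -/
lemma exists_bijective_colDist_le {ℓ w e k : ℕ} {t : ℝ} (ht : 1 ≤ t) (hℓ : 15 ≤ ℓ)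
    (he : (t + 1) * Real.logb 2 ℓ ≤ e) (hk : k + w + e ≤ ℓ) :
    ∃ f : (Fin ℓ → ZMod 2) → Fin ℓ → ZMod 2, Function.Bijective f ∧
      ∀ W K : Finset (Fin ℓ), W.card = w → K.card = k → ∀ a : K → ZMod 2,
        colDist f W K a ≤ (ℓ : ℝ) ^ (-(t / 2)) := by
  have hℓ0 : (0 : ℝ) < ℓ := by exact_mod_cast (by omega : 0 < ℓ)
  have hpos : 0 ≤ (ℓ : ℝ) ^ (-(t / 2)) := (Real.rpow_pos_of_pos hℓ0 _).le
  rcases (by omega : w = 0 ∨ w = 1 ∨ 2 ≤ w) with rfl | rfl | hw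
  · refine ⟨id, Function.bijective_id, fun W K hW _ a => ?_⟩
    rwa [colDist_eq_zero_of_card_eq_zero _ W K a hW]
  · refine ⟨parityCode ℓ, parityCode_bijective ℓ, fun W K hW hK a => ?_⟩
    have he1 : 1 ≤ e := by
      have h1 : 0 < Real.logb 2 (ℓ : ℝ) :=
        Real.logb_pos one_lt_two (by exact_mod_cast (by omega : 1 < ℓ))
      have h2 : (0 : ℝ) < e := lt_of_lt_of_le (by positivity) he
      exact_mod_cast h2
    rwa [colDist_parityCode W K a hW (by omega)]
  · have hs : ((ℓ : ℝ) ^ (-(t / 2))) ^ 2 = (ℓ : ℝ) ^ (-t) := by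
      rw [← Real.rpow_natCast, ← Real.rpow_mul hℓ0.le]
      congr 1
      push_cast; ring
    have hy : 2 ^ w * (ℓ : ℝ) ≤ 2 ^ (ℓ - k) * ((ℓ : ℝ) ^ (-(t / 2))) ^ 2 := by
      rw [hs]
      have h1 := rpow_le_two_pow (by omega : 0 < ℓ) he
      have h2 : (2 : ℝ) ^ (w + e) ≤ 2 ^ (ℓ - k) := pow_le_pow_right₀ one_le_two (by omega)
      have h3 : (ℓ : ℝ) ^ (t + 1) * (ℓ : ℝ) ^ (-t) = ℓ := by
        rw [← Real.rpow_add hℓ0]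
        simp
      have h4 : 0 ≤ (ℓ : ℝ) ^ (-t) := (Real.rpow_pos_of_pos hℓ0 _).le
      calc 2 ^ w * (ℓ : ℝ) = 2 ^ w * (ℓ : ℝ) ^ (t + 1) * (ℓ : ℝ) ^ (-t) := by
            rw [mul_assoc, h3]
        _ ≤ 2 ^ w * 2 ^ e * (ℓ : ℝ) ^ (-t) := by gcongr
        _ ≤ _ := by
          rw [← pow_add]
          exact mul_le_mul_of_nonneg_right h2 h4
    obtain ⟨σ, hσ⟩ := exists_perm_colDist_le (ℓ := ℓ) (w := w) (k := k) hpos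
      (union_bound_lt_one hℓ hw hy)
    exact ⟨σ, σ.bijective, hσ⟩

/-! ### Asymptotics -/

section Asymptotics

variable {p β t : ℝ} {ℓ : ℕ → ℕ}

lemma eventually_compLen_pos (hℓ : ∀ m, 0 < ℓ m)
    (h : (fun m => (ℓ m : ℝ)) =o[atTop]
        fun m => (2 : ℝ) ^ (((2 : ℝ) ^ m) ^ β) / (compLen p β m : ℝ)) :
    ∀ᶠ m in atTop, (1 : ℝ) ≤ compLen p β m := by
  filter_upwards [isLittleO_iff.1 h one_pos] with m hm
  rcases Nat.eq_zero_or_pos (compLen p β m) with h0 | h0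
  -- For `ñ = 0` the quotient is `0` by the convention on division by zero, and the bound would
  -- force `ℓ m = 0`.
  · rw [h0] at hm
    simp at hm
    exact absurd hm (hℓ m).ne'
  · exact_mod_cast h0

lemma tendsto_compLen_mul_delta
    (h : (fun m => (ℓ m : ℝ)) =o[atTop]
        fun m => (2 : ℝ) ^ (((2 : ℝ) ^ m) ^ β) / (compLen p β m : ℝ)) :
    Tendsto (fun m => (compLen p β m : ℝ) * ℓ m * delta β m) atTop (𝓝 0) := by
  rw [Metric.tendsto_nhds]
  intro ε hε
  filter_upwards [isLittleO_iff.1 h (half_pos hε)] with m hm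
  have hδ := delta_pos m β
  have hδe : delta β m = ((2 : ℝ) ^ (((2 : ℝ) ^ m) ^ β))⁻¹ := Real.rpow_neg two_pos.le _
  have hn : (0 : ℝ) ≤ compLen p β m := Nat.cast_nonneg _
  have hl : (0 : ℝ) ≤ ℓ m := Nat.cast_nonneg _
  rw [Real.dist_eq, sub_zero, abs_of_nonneg (by positivity)]
  have hX : (0 : ℝ) < (2 : ℝ) ^ (((2 : ℝ) ^ m) ^ β) := Real.rpow_pos_of_pos two_pos _
  rw [Real.norm_of_nonneg hl, Real.norm_of_nonneg (by positivity)] at hm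
  rcases hn.eq_or_lt with h0 | h0
  · rw [← h0]; simpa using hε
  · calc (compLen p β m : ℝ) * ℓ m * delta β m ≤ compLen p β m *
          (ε / 2 * ((2 : ℝ) ^ (((2 : ℝ) ^ m) ^ β) / (compLen p β m : ℝ))) * delta β m := by gcongr
      _ = ε / 2 := by rw [hδe]; field_simp
      _ < ε := half_lt_self hε

lemma tendsto_delta (hℓ : ∀ m, 0 < ℓ m)
    (h : (fun m => (ℓ m : ℝ)) =o[atTop]
        fun m => (2 : ℝ) ^ (((2 : ℝ) ^ m) ^ β) / (compLen p β m : ℝ)) :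
    Tendsto (fun m => (ℓ m : ℝ) * delta β m) atTop (𝓝 0) ∧ Tendsto (delta β) atTop (𝓝 0) := by
  have h1 : ∀ m, (1 : ℝ) ≤ ℓ m := fun m => by exact_mod_cast hℓ m
  have h2 : Tendsto (fun m => (ℓ m : ℝ) * delta β m) atTop (𝓝 0) := by
    refine squeeze_zero' (Eventually.of_forall fun m =>
      mul_nonneg (Nat.cast_nonneg _) (delta_pos m β).le) ?_ (tendsto_compLen_mul_delta h)
    filter_upwards [eventually_compLen_pos hℓ h] with m hm
    have := mul_nonneg (Nat.cast_nonneg (α := ℝ) (ℓ m)) (delta_pos m β).le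
    nlinarith
  refine ⟨h2, squeeze_zero (fun m => (delta_pos m β).le) (fun m => ?_) h2⟩
  have := delta_pos m β
  have := h1 m
  nlinarith

lemma neg_logb_max_pos (hp0 : 0 < p) (hp1 : p < 1) : 0 < -Real.logb 2 (max p (1 - p)) :=
  neg_pos.2 (Real.logb_neg one_lt_two (lt_max_of_lt_left hp0) (max_lt hp1 (by linarith)))

lemma eventually_two_pow_le_compLen (hp0 : 0 < p) (hp1 : p < 1)
    (h : Tendsto (delta β) atTop (𝓝 0)) :
    ∀ᶠ m in atTop, 2 ^ m * (-Real.logb 2 (max p (1 - p)) / 2) ≤ (compLen p β m : ℝ) := by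
  have hκ := neg_logb_max_pos hp0 hp1
  filter_upwards [h.eventually (gt_mem_nhds (half_pos hκ))] with m hm
  refine le_trans ?_ (compLen_ge hp0 hp1 m β)
  gcongr
  linarith

lemma tendsto_compLen (hp0 : 0 < p) (hp1 : p < 1) (h : Tendsto (delta β) atTop (𝓝 0)) :
    Tendsto (fun m => (compLen p β m : ℝ)) atTop atTop :=
  tendsto_atTop_mono' _ (eventually_two_pow_le_compLen hp0 hp1 h)
    ((tendsto_pow_atTop_atTop_of_one_lt one_lt_two).atTop_mul_const
      (half_pos (neg_logb_max_pos hp0 hp1)))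

lemma tendsto_links (ht : 0 < t) (hn : Tendsto (fun m => (compLen p β m : ℝ)) atTop atTop)
    (h : (fun m => (compLen p β m : ℝ) ^ (2 / t)) =o[atTop] fun m => (ℓ m : ℝ)) :
    Tendsto (fun m => (ℓ m : ℝ)) atTop atTop := by
  refine tendsto_atTop_mono' _ ?_ ((tendsto_rpow_atTop (y := 2 / t) (by positivity)).comp hn)
  filter_upwards [isLittleO_iff.1 h one_pos] with m hm
  rw [Real.norm_of_nonneg (by positivity), Real.norm_of_nonneg (by positivity), one_mul] at hm
  exact hm

lemma tendsto_compLen_mul_rpow (ht : 0 < t) (hℓ : ∀ m, 0 < ℓ m)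
    (h : (fun m => (compLen p β m : ℝ) ^ (2 / t)) =o[atTop] fun m => (ℓ m : ℝ)) :
    Tendsto (fun m => (compLen p β m : ℝ) * (ℓ m : ℝ) ^ (-(t / 2))) atTop (𝓝 0) := by
  rw [Metric.tendsto_nhds]
  intro ε hε
  filter_upwards [isLittleO_iff.1 h (Real.rpow_pos_of_pos (half_pos hε) (2 / t))] with m hm
  have hl : (0 : ℝ) < ℓ m := by exact_mod_cast hℓ m
  have hn : (0 : ℝ) ≤ compLen p β m := Nat.cast_nonneg _
  rw [Real.norm_of_nonneg (by positivity), Real.norm_of_nonneg hl.le] at hm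
  rw [Real.dist_eq, sub_zero, abs_of_nonneg (by positivity)]
  have h1 := Real.rpow_le_rpow (by positivity) hm (show 0 ≤ t / 2 by positivity)
  have h2 : 2 / t * (t / 2) = 1 := by field_simp
  rw [Real.mul_rpow (by positivity) hl.le, ← Real.rpow_mul hn, ← Real.rpow_mul (by positivity), h2,
    Real.rpow_one, Real.rpow_one] at h1
  have hL := Real.rpow_pos_of_pos hl (t / 2)
  rw [Real.rpow_neg hl.le, ← div_eq_mul_inv, div_lt_iff₀ hL]
  nlinarith

lemma tendsto_leakBound (ht : 0 < t) (hℓ : ∀ m, 0 < ℓ m)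
    (h1 : (fun m => (compLen p β m : ℝ) ^ (2 / t)) =o[atTop] fun m => (ℓ m : ℝ))
    (h2 : (fun m => (ℓ m : ℝ)) =o[atTop]
        fun m => (2 : ℝ) ^ (((2 : ℝ) ^ m) ^ β) / (compLen p β m : ℝ)) :
    Tendsto (fun m => leakBound p β t m (ℓ m)) atTop (𝓝 0) := by
  have h3 := ((tendsto_compLen_mul_delta h2).const_mul 2).sqrt
  have h4 := (tendsto_compLen_mul_rpow ht hℓ h1).add (h3.const_mul 2)
  simp only [mul_zero, Real.sqrt_zero, add_zero] at h4
  refine h4.congr fun m => ?_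
  unfold leakBound
  ring_nf

lemma tendsto_errBound (hp0 : 0 < p) (hp1 : p < 1) (ht : 0 < t) (hℓ : ∀ m, 0 < ℓ m)
    (h1 : (fun m => (compLen p β m : ℝ) ^ (2 / t)) =o[atTop] fun m => (ℓ m : ℝ))
    (h2 : (fun m => (ℓ m : ℝ)) =o[atTop]
        fun m => (2 : ℝ) ^ (((2 : ℝ) ^ m) ^ β) / (compLen p β m : ℝ)) (c : ℝ) :
    Tendsto (fun m => errBound c p β m (ℓ m)) atTop (𝓝 0) := by
  obtain ⟨hLδ, hδ⟩ := tendsto_delta hℓ h2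
  have hL := tendsto_links ht (tendsto_compLen hp0 hp1 hδ) h1
  have h3 := ((tendsto_compLen_mul_delta h2).const_mul 2).sqrt
  have h5 := ((tendsto_rpow_mul_exp_neg_mul_atTop_nhds_zero (t / 2) (Real.log 2)
    (Real.log_pos one_lt_two)).comp hL)
  -- The channel term is split as `ñ 2^{-ℓ} = (ñ ℓ^{-t/2}) (ℓ^{t/2} 2^{-ℓ})`, both factors tending
  -- to zero.
  have h6 := ((tendsto_compLen_mul_rpow ht hℓ h1).mul h5).const_mul c
  have h7 := (h6.add h3).add hLδ
  simp only [mul_zero, Real.sqrt_zero, add_zero] at h7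
  refine h7.congr fun m => ?_
  have hl : (0 : ℝ) < ℓ m := by exact_mod_cast hℓ m
  have e1 : (ℓ m : ℝ) ^ (-(t / 2)) * (ℓ m : ℝ) ^ (t / 2) = 1 := by
    rw [← Real.rpow_add hl]; simp
  have e2 : (2 : ℝ) ^ (-(ℓ m : ℝ)) = Real.exp (-Real.log 2 * ℓ m) := by
    rw [Real.rpow_def_of_pos two_pos]; ring_nf
  unfold errBound
  rw [e2, show (2 : ℝ) * compLen p β m * ℓ m * delta β m =
    2 * (compLen p β m * ℓ m * delta β m) by ring]
  simp only [Function.comp_apply]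
  linear_combination (c * compLen p β m * Real.exp (-Real.log 2 * ℓ m)) * e1

/-- The source error bound `ℓ n δ` carries a factor `n` that the last term of `ε_e` lacks, so the
square root absorbs it. With `n ≤ (2 / κ) ñ`, its square is at most `(4 / κ²) (ñ ℓ δ)²`, and `ñ ℓ δ
≤ κ² / 2` eventually. -/
lemma eventually_error_le_sqrt (hp0 : 0 < p) (hp1 : p < 1) (hℓ : ∀ m, 0 < ℓ m)
    (h : (fun m => (ℓ m : ℝ)) =o[atTop]
        fun m => (2 : ℝ) ^ (((2 : ℝ) ^ m) ^ β) / (compLen p β m : ℝ)) :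
    ∀ᶠ m in atTop, (ℓ m : ℝ) * (2 ^ m * delta β m) ≤
      √(2 * (compLen p β m : ℝ) * (ℓ m : ℝ) * delta β m) := by
  have hκ := neg_logb_max_pos hp0 hp1
  set κ := -Real.logb 2 (max p (1 - p))
  filter_upwards [eventually_two_pow_le_compLen hp0 hp1 (tendsto_delta hℓ h).2,
    (tendsto_compLen_mul_delta h).eventually (ge_mem_nhds (show (0 : ℝ) < κ ^ 2 / 2 by positivity))]
    with m h1 h2
  have hδ := delta_pos m β
  have hl : (0 : ℝ) < ℓ m := by exact_mod_cast hℓ m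
  have hn : (0 : ℝ) ≤ compLen p β m := Nat.cast_nonneg _
  set N : ℝ := (compLen p β m : ℝ)
  set x : ℝ := ℓ m * delta β m
  have hx : 0 < x := mul_pos hl hδ
  have h2' : N * x ≤ κ ^ 2 / 2 := by rw [← mul_assoc]; exact h2
  have h3 : (2 ^ m * (κ / 2)) ^ 2 ≤ N ^ 2 := pow_le_pow_left₀ (by positivity) h1 2
  refine Real.le_sqrt_of_sq_le ?_
  have e1 : ((ℓ m : ℝ) * (2 ^ m * delta β m)) ^ 2 = (2 ^ m) ^ 2 * x ^ 2 := by ring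
  have e2 : 2 * N * (ℓ m : ℝ) * delta β m = 2 * N * x := by ring
  rw [e1, e2]
  refine le_of_mul_le_mul_left ?_ (show 0 < (κ / 2) ^ 2 by positivity)
  calc (κ / 2) ^ 2 * ((2 ^ m) ^ 2 * x ^ 2) = (2 ^ m * (κ / 2)) ^ 2 * x ^ 2 := by ring
    _ ≤ N ^ 2 * x ^ 2 := by gcongr
    _ = (N * x) * (N * x) := by ring
    _ ≤ κ ^ 2 / 2 * (N * x) := by gcongr
    _ = _ := by ring

end Asymptotics

end NUHUNCC
end

/-! ### Assembly of the theorem -/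

open NUHUNCC in
theorem theorem2 :
    ∃ c : ℝ, ∀ (p β t : ℝ), 0 < p → p < 1 → 0 ≤ β → β < 1 / 2 → 1 ≤ t →
    ∀ (ℓ w e d : ℕ → ℕ),
      (∀ m, w m < ℓ m) →
      (∀ m, (NUHUNCC.midSet p β m).card ≤ d m) →
      ((fun m => (e m : ℝ)) =o[atTop] fun m => (ℓ m : ℝ)) →
      ((fun m => (NUHUNCC.compLen p β m : ℝ) ^ (2 / t)) =o[atTop] fun m => (ℓ m : ℝ)) →
      ((fun m => (ℓ m : ℝ)) =o[atTop]
        fun m => (2 : ℝ) ^ (((2 : ℝ) ^ m) ^ β) / (NUHUNCC.compLen p β m : ℝ)) →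
      (∀ᶠ m in atTop, (t + 1) * Real.logb 2 (ℓ m) ≤ (e m : ℝ) →
        ∀ ks : ℕ, ks + w m + e m ≤ ℓ m →
        ∃ C : NUHUNCC.Codebook (ℓ m) ks,
          NUHUNCC.errorProb p β m (d m) C ≤ NUHUNCC.errBound c p β m (ℓ m) ∧
          ∀ W K : Finset (Fin (ℓ m)), W.card = w m → K.card = ks →
          ∀ v : K → Fin (2 ^ m) → ZMod 2,
            NUHUNCC.leakage p β m (d m) C W K v ≤ NUHUNCC.leakBound p β t m (ℓ m)) ∧
      (∀ m, t * Real.logb 2 (ℓ m) ≤ (e m : ℝ) →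
        ∀ ks : ℕ, ks + w m + e m ≤ ℓ m →
        ∀ W K : Finset (Fin (ℓ m)), W.card = w m → K.card = ks →
        ∀ v : K → Fin (2 ^ m) → ZMod 2,
          NUHUNCC.meanLeakage p β m ks (d m) W K v ≤ NUHUNCC.leakBound p β t m (ℓ m)) ∧
      Tendsto (fun m => NUHUNCC.leakBound p β t m (ℓ m)) atTop (𝓝 0) ∧
      Tendsto (fun m => NUHUNCC.errBound c p β m (ℓ m)) atTop (𝓝 0) := by
  -- The chosen codebook is bijective and has no channel error, so any `c ≥ 0` would do.
  refine ⟨1, fun p β t hp0 hp1 _ _ ht ℓ w e d hw hd _ h1 h2 => ?_⟩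
  have hℓ : ∀ m, 0 < ℓ m := fun m => (Nat.zero_le _).trans_lt (hw m)
  have ht0 : 0 < t := one_pos.trans_le ht
  refine ⟨?_, ?_, tendsto_leakBound ht0 hℓ h1 h2, tendsto_errBound hp0 hp1 ht0 hℓ h1 h2 1⟩
  · have hL := tendsto_links ht0 (tendsto_compLen hp0 hp1 (tendsto_delta hℓ h2).2) h1
    filter_upwards [eventually_error_le_sqrt hp0 hp1 hℓ h2, hL.eventually_ge_atTop 15]
      with m herr h15 he ks hks
    obtain ⟨f, hf, hfd⟩ := exists_bijective_colDist_le ht (by exact_mod_cast h15) he hks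
    have hC : chEncode ((codebookEquiv (ℓ m) ks).symm f) = f :=
      (codebookEquiv (ℓ m) ks).apply_symm_apply f
    refine ⟨(codebookEquiv (ℓ m) ks).symm f, ?_, fun W K hW hK v => ?_⟩
    · refine (errorProb_le hp0 hp1 β m (d m) _ (by rw [hC]; exact hf.injective)).trans
        (herr.trans ?_)
      have := mul_nonneg (Nat.cast_nonneg (α := ℝ) (ℓ m)) (delta_pos m β).le
      have : 0 ≤ (compLen p β m : ℝ) * (1 * (2 : ℝ) ^ (-(ℓ m : ℝ))) := by positivity
      unfold errBound
      linarith
    · refine (leakage_le hp0 hp1 β m (hd m) _ W K v).trans (add_le_add ?_ le_rfl)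
      rw [hC]
      refine (Finset.sum_le_sum fun j _ => hfd W K hW hK _).trans ?_
      rw [Finset.sum_const, Finset.card_univ, nsmul_eq_mul, Fintype.card_coe]
      refine mul_le_mul_of_nonneg_right ?_ (by positivity)
      exact_mod_cast Nat.le_add_right _ _
  · intro m he ks hks W K hW hK v
    refine (meanLeakage_le hp0 hp1 β m (hd m) W K (e := e m) (by omega) v).trans
      (add_le_add ?_ le_rfl)
    exact mul_le_mul_of_nonneg_left (sqrt_half_pow_le (hℓ m) he) (Nat.cast_nonneg _)
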